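/- Let $q$ be a prime power and let $\mathrm{PG}(2,q^2)$ be the Desarguesian projective plane over the field $\mathbb{F}_{q^2}$. A *unital* in $\mathrm{PG}(2,q^2)$ is a set of $q^3+1$ points meeting every line in either $1$ or $q+1$ points; it is *classical* (or *Hermitian*) if it is the set of absolute points of a non-degenerate unitary polarity of $\mathrm{PG}(2,q^2)$. **Theorem.** Let $\mathcal U$ be a unital in $\mathrm{PG}(2,q^2)$ and let $M\le \mathrm{PGL}(3,q^2)$ be the group of all projectivities preserving $\mathcal U$. If there are two distinct points $P,Q\in\mathcal U$ such that the stabiliser $M_{P,Q}$ (the subgroup of all elements of $M$ fixing both $P$ and $Q$) has order $q^2-1$, then $\mathcal U$ is classical. Conversely, if $\mathcal U$ is classical, then such points $P,Q$ exist. Thus $\mathcal U$ is classical if and only if it has two distinct points $P,Q$ with $|M_{P,Q}|=q^2-1$. -/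

import Mathlib

open scoped LinearAlgebra.Projectivization Pointwise

/-- The points of the Desarguesian projective plane over `K`. -/
abbrev PlanePoint (K : Type*) [Field K] : Type _ := ℙ K (Fin 3 → K)

/-- The lines of the Desarguesian projective plane over `K`: the two-dimensional subspaces of the
underlying three-dimensional vector space. -/
abbrev PlaneLine (K : Type*) [Field K] : Type _ :=
  {W : Submodule K (Fin 3 → K) // Module.finrank K W = 2}

/-- The set of points on a line. -/
def PlaneLine.points {K : Type*} [Field K] (l : PlaneLine K) : Set (PlanePoint K) :=
  {P | P.submodule ≤ l.1}

/-- A unital in the plane over a field with `q ^ 2` elements: a set of `q ^ 3 + 1` points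
meeting each line in either `1` or `q + 1` points. -/
def IsUnital {K : Type*} [Field K] (q : ℕ) (U : Set (PlanePoint K)) : Prop :=
  U.ncard = q ^ 3 + 1 ∧
    ∀ l : PlaneLine K, (U ∩ l.points).ncard = 1 ∨ (U ∩ l.points).ncard = q + 1

/-- The pairing `∑ xᵢ ^ q * Hᵢⱼ * yⱼ` attached to a matrix `H`. -/
def unitaryPairing {K : Type*} [Field K] (q : ℕ) (H : Matrix (Fin 3) (Fin 3) K)
    (x y : Fin 3 → K) : K :=
  ∑ i, ∑ j, x i ^ q * H i j * y j

/-- A map `π` from points to lines is a non-degenerate unitary polarity if it sends each point to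
its orthogonal line with respect to an invertible matrix that is Hermitian for the involution
`a ↦ a ^ q` of the field with `q ^ 2` elements. -/
def IsUnitaryPolarity {K : Type*} [Field K] (q : ℕ) (π : PlanePoint K → PlaneLine K) : Prop :=
  ∃ H : Matrix (Fin 3) (Fin 3) K, (∀ i j, H j i = H i j ^ q) ∧ IsUnit H.det ∧
    ∀ (v : Fin 3 → K) (hv : v ≠ 0) (w : Fin 3 → K),
      w ∈ (π (Projectivization.mk K v hv)).1 ↔ unitaryPairing q H v w = 0

/-- A point is absolute for `π` if it lies on its image. -/
def absolutePoints {K : Type*} [Field K] (π : PlanePoint K → PlaneLine K) :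
    Set (PlanePoint K) :=
  {P | P ∈ (π P).points}

/-- A set of points is a classical (Hermitian) unital if it is the set of absolute points of a
non-degenerate unitary polarity. -/
def IsClassicalUnital {K : Type*} [Field K] (q : ℕ) (U : Set (PlanePoint K)) : Prop :=
  ∃ π : PlanePoint K → PlaneLine K, IsUnitaryPolarity q π ∧ U = absolutePoints π

/-- The group of all projectivities of the plane that preserve the point set `U`. -/
def projectivityGroup {K : Type*} [Field K] (U : Set (PlanePoint K)) :
    Subgroup (Matrix.ProjGenLinGroup (Fin 3) K) :=
  MulAction.stabilizer (Matrix.ProjGenLinGroup (Fin 3) K) U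

/-- The subgroup of `projectivityGroup U` fixing both `P` and `Q`. -/
def twoPointStabilizer {K : Type*} [Field K] (U : Set (PlanePoint K)) (P Q : PlanePoint K) :
    Subgroup (projectivityGroup U) :=
  MulAction.stabilizer (projectivityGroup U) P ⊓ MulAction.stabilizer (projectivityGroup U) Q

/-!
Let `K` be the field with `q ^ 2` elements and `U` a unital. For two points `P`, `Q` of `U` choose
coordinates such that `P = (1 : 0 : 0)`, `Q = (0 : 0 : 1)` and the tangents at `P` and `Q` meet in
`(0 : 1 : 0)` (`IsUnital.exists_isTangentFrame`). A projectivity fixing `P`, `Q` and `U` fixes these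
tangents, so that the stabilizer of `P` and `Q` is identified with the group of diagonal maps
`(1 : y : w) ↦ (1 : h * y : l * w)` preserving the part `V` of `U` in the affine chart
(`IsTangentFrame.card_twoPointStabilizer`).

If `U` is classical, the polar lines of `P` and `Q` are the tangents, so that `V` has an equation
`a * y ^ (q + 1) + b * w + b ^ q * w ^ q = 0` (`IsTangentFrame.exists_equation`). It is preserved
exactly by the maps with `l = h ^ (q + 1)`, and there are `q ^ 2 - 1` of these (`card_chartGroup`).

Conversely, let the stabilizer have order `q ^ 2 - 1`. The values of `l` act freely on a set of
`q - 1` points, and the maps with `l = 1` on a set of at most `q + 1` points. Hence both bounds are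
attained and `V` has an equation `y ^ (q + 1) = ψ w`, where `ψ` takes values in the subfield
of order `q`, vanishes exactly on the multiples of some `c` by that subfield, and satisfies counting
conditions expressing that lines meet `U` in `1` or `q + 1` points
(`IsUnitalChart.exists_isUnitalFunction`). It remains to show that such a function is of the form
`ψ w = b * w + b ^ q * w ^ q` (`IsUnitalFunction.exists_eq_trace`), since this is the equation of a
Hermitian curve. Three ingredients combine.

* Each point `(1 : 0 : β)` off `U` has a tangent value `θ β`. The product of
  `(w - β) ^ (q + 1) / ψ w` over all `w` gives `c ^ (q - 1) * (ψ * θ) = M ^ 2` with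
  `M w = w ^ q - c ^ (q - 1) * w` (`IsUnitalFunction.mul_tangent`).
* For the Teichmüller character `χ` of `K` in the ring of Witt vectors, the counting conditions
  imply that `∑ w, χ⁻¹ ((w - β) ^ (q + 1)) * χ (ψ w)` is divisible by `q`, and the same holds
  for `θ`. Jacobi sum congruences turn this into the vanishing of the coefficients of
  `w ^ (s + q * t)` in `ψ` and `θ` for all nonzero digits `s`, `t < q` which are not both divisible
  by `p` (`NormSumsDvd.coeff_eq_zero`).
* Comparing the coefficients of `w ^ 2` in `ψ * θ` and `M ^ 2`, the digit conditions leave only the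
  product of the linear coefficients of `ψ` and `θ` (`powerCoeff_one_ne_zero`). These are therefore
  nonzero, so `ψ` and `θ` are homogeneous of degree one over the subfield of order `q`.

Homogeneity and the digit conditions make `ψ ^ (q / p)` and `θ ^ (q / p)` forms of degree `q / p` in
`w` and `w ^ q` whose product is a multiple of `M ^ (2 * (q / p))`. By unique factorization of
polynomials each of them is a multiple of `M ^ (q / p)`, and hence `ψ` is a multiple of `M`
(`IsUnitalFunction.exists_eq_mul`). For `q = 2` the last statement is immediate.
-/

/-! ### The norm of a quadratic extension of finite fields -/

section Norm

variable {K : Type*} [Field K] [Fintype K] {q : ℕ}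

lemma pow_q_pow_q (hcard : Fintype.card K = q ^ 2) (x : K) : (x ^ q) ^ q = x := by
  rw [← pow_mul, ← pow_two, ← hcard, FiniteField.pow_card]

lemma one_lt_of_card_eq_sq (hcard : Fintype.card K = q ^ 2) : 1 < q := by
  have h := Fintype.one_lt_card (α := K)
  rw [hcard] at h
  by_contra hq
  interval_cases q <;> simp at h

lemma norm_pow_q (hcard : Fintype.card K = q ^ 2) (x : K) : (x ^ (q + 1)) ^ q = x ^ (q + 1) := by
  rw [← pow_mul, mul_comm, pow_mul, pow_succ, pow_q_pow_q hcard, pow_succ, mul_comm]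

lemma exists_prime_pow_eq (hcard : Fintype.card K = q ^ 2) :
    ∃ p h : ℕ, p.Prime ∧ CharP K p ∧ 0 < h ∧ q = p ^ h := by
  obtain ⟨p, hp⟩ := CharP.exists K
  obtain ⟨n, hpp, hn⟩ := FiniteField.card K p
  rw [hcard] at hn
  obtain ⟨h, -, hh⟩ := (Nat.dvd_prime_pow hpp).mp (hn ▸ dvd_pow_self q two_ne_zero)
  refine ⟨p, h, hpp, hp, Nat.pos_of_ne_zero ?_, hh⟩
  rintro rfl
  have := one_lt_of_card_eq_sq hcard
  simp [hh] at this

lemma add_pow_q (hcard : Fintype.card K = q ^ 2) (x y : K) : (x + y) ^ q = x ^ q + y ^ q := by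
  obtain ⟨p, h, hp, _, -, rfl⟩ := exists_prime_pow_eq hcard
  have := Fact.mk hp
  exact add_pow_char_pow x y p h

lemma sub_pow_q (hcard : Fintype.card K = q ^ 2) (x y : K) : (x - y) ^ q = x ^ q - y ^ q := by
  obtain ⟨p, h, hp, _, -, rfl⟩ := exists_prime_pow_eq hcard
  have := Fact.mk hp
  exact sub_pow_char_pow (R := K) (p := p) (n := h) x y

lemma neg_one_pow_q (hcard : Fintype.card K = q ^ 2) : (-1 : K) ^ q = -1 := by
  have := sub_pow_q hcard (0 : K) 1
  rwa [zero_sub, zero_pow (by have := one_lt_of_card_eq_sq hcard; omega), one_pow, zero_sub] at this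

lemma neg_one_pow_q_add_one (hcard : Fintype.card K = q ^ 2) : (-1 : K) ^ (q + 1) = 1 := by
  rw [pow_succ, neg_one_pow_q hcard]; ring

lemma cast_q_eq_zero (hcard : Fintype.card K = q ^ 2) : (q : K) = 0 := by
  obtain ⟨p, h, hp, _, h0, rfl⟩ := exists_prime_pow_eq hcard
  rw [Nat.cast_pow, CharP.cast_eq_zero, zero_pow h0.ne']

variable (K q) in
/-- The nonzero elements of the subfield with `q` elements. -/
noncomputable def subfieldUnits : Finset K := by
  classical exact Finset.univ.filter fun x => x ≠ 0 ∧ x ^ q = x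

@[simp] lemma mem_subfieldUnits {x : K} : x ∈ subfieldUnits K q ↔ x ≠ 0 ∧ x ^ q = x := by
  simp [subfieldUnits]

lemma norm_mem_subfieldUnits (hcard : Fintype.card K = q ^ 2) {x : K} (hx : x ≠ 0) :
    x ^ (q + 1) ∈ subfieldUnits K q :=
  mem_subfieldUnits.mpr ⟨pow_ne_zero _ hx, norm_pow_q hcard x⟩

lemma inv_mem_subfieldUnits {x : K} (hx : x ∈ subfieldUnits K q) : x⁻¹ ∈ subfieldUnits K q := by
  rw [mem_subfieldUnits] at *
  exact ⟨inv_ne_zero hx.1, by rw [inv_pow, hx.2]⟩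

lemma div_mem_subfieldUnits {x y : K} (hx : x ∈ subfieldUnits K q) (hy : y ∈ subfieldUnits K q) :
    x / y ∈ subfieldUnits K q := by
  rw [mem_subfieldUnits] at *
  exact ⟨div_ne_zero hx.1 hy.1, by rw [div_pow, hx.2, hy.2]⟩

lemma pow_sub_one_eq_one_iff {K : Type*} [Field K] {q : ℕ} (hq : 0 < q) {x : K} (hx : x ≠ 0) :
    x ^ (q - 1) = 1 ↔ x ^ q = x := by
  obtain ⟨r, rfl⟩ : ∃ r, q = r + 1 := ⟨q - 1, by omega⟩
  rw [Nat.add_sub_cancel, pow_succ]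
  exact ⟨fun h => by rw [h, one_mul], fun h => mul_right_cancel₀ hx (by rw [h, one_mul])⟩

lemma card_sq_sub_one (hcard : Fintype.card K = q ^ 2) :
    Nat.card Kˣ = (q + 1) * (q - 1) := by
  classical
  rw [Nat.card_eq_fintype_card, Fintype.card_units, hcard]
  have := one_lt_of_card_eq_sq hcard
  obtain ⟨r, rfl⟩ : ∃ r, q = r + 1 := ⟨q - 1, by omega⟩
  rw [Nat.add_sub_cancel, Nat.sub_eq_iff_eq_add (Nat.one_le_pow _ _ (by omega))]
  ring

lemma card_subfieldUnits (hcard : Fintype.card K = q ^ 2) : (subfieldUnits K q).card = q - 1 := by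
  classical
  have hq := one_lt_of_card_eq_sq hcard
  have h1 := IsCyclic.card_powMonoidHom_ker (G := Kˣ) (q - 1)
  rw [card_sq_sub_one hcard, Nat.gcd_eq_right (Dvd.intro_left _ rfl)] at h1
  rw [← h1, ← Nat.card_eq_finsetCard]
  refine Nat.card_congr
    { toFun := fun x => ⟨Units.mk0 x (mem_subfieldUnits.mp x.2).1, ?_⟩
      invFun := fun u => ⟨(u : Kˣ), ?_⟩
      left_inv := fun x => by simp
      right_inv := fun u => by simp }
  · rw [MonoidHom.mem_ker, powMonoidHom_apply]
    ext
    simpa using (pow_sub_one_eq_one_iff (by omega) (mem_subfieldUnits.mp x.2).1).mpr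
      (mem_subfieldUnits.mp x.2).2
  · have h2 := u.2
    rw [MonoidHom.mem_ker, powMonoidHom_apply] at h2
    refine mem_subfieldUnits.mpr ⟨(u : Kˣ).ne_zero, ?_⟩
    exact (pow_sub_one_eq_one_iff (by omega) (u : Kˣ).ne_zero).mp (by
      simpa using congrArg Units.val h2)

/-- The norm to the subfield with `q` elements is surjective. -/
lemma exists_pow_q_add_one_eq (hcard : Fintype.card K = q ^ 2) {n : K}
    (hn : n ∈ subfieldUnits K q) :
    ∃ x : K, x ≠ 0 ∧ x ^ (q + 1) = n := by
  classical
  have hq := one_lt_of_card_eq_sq hcard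
  rw [mem_subfieldUnits] at hn
  have h1 := IsCyclic.card_powMonoidHom_ker (G := Kˣ) (q - 1)
  have h2 := IsCyclic.card_powMonoidHom_range (G := Kˣ) (q + 1)
  rw [card_sq_sub_one hcard, Nat.gcd_eq_right (Dvd.intro_left _ rfl)] at h1
  rw [card_sq_sub_one hcard, Nat.gcd_eq_right (Dvd.intro _ rfl),
    Nat.mul_div_cancel_left _ (by omega)] at h2
  have h3 : (powMonoidHom (q + 1) : Kˣ →* Kˣ).range ≤ (powMonoidHom (q - 1) : Kˣ →* Kˣ).ker := by
    rintro _ ⟨x, rfl⟩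
    rw [MonoidHom.mem_ker, powMonoidHom_apply, powMonoidHom_apply, ← pow_mul,
      ← card_sq_sub_one hcard, pow_card_eq_one']
  have h4 := Subgroup.eq_of_le_of_card_ge h3 (by rw [h1, h2])
  have h5 : Units.mk0 n hn.1 ∈ (powMonoidHom (q - 1) : Kˣ →* Kˣ).ker := by
    rw [MonoidHom.mem_ker, powMonoidHom_apply]
    ext
    simpa using (pow_sub_one_eq_one_iff (by omega) hn.1).mpr hn.2
  rw [← h4] at h5
  obtain ⟨x, hx⟩ := h5
  exact ⟨x, x.ne_zero, by simpa using congrArg Units.val hx⟩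

open Polynomial in
lemma prod_X_sub_C_subfieldUnits (hcard : Fintype.card K = q ^ 2) :
    ∏ f ∈ subfieldUnits K q, (X - C f) = (X ^ (q - 1) - 1 : K[X]) := by
  have hq := one_lt_of_card_eq_sq hcard
  have hm1 : (∏ f ∈ subfieldUnits K q, (X - C f)).Monic := monic_prod_X_sub_C _ _
  have hm2 : (X ^ (q - 1) - 1 : K[X]).Monic := monic_X_pow_sub_C 1 (by omega)
  have hd1 : (∏ f ∈ subfieldUnits K q, (X - C f)).degree = ((q - 1 : ℕ) : WithBot ℕ) := by
    rw [degree_prod]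
    simp [card_subfieldUnits hcard]
  have hd2 : (X ^ (q - 1) - 1 : K[X]).degree = ((q - 1 : ℕ) : WithBot ℕ) :=
    degree_X_pow_sub_C (by omega) 1
  rw [← sub_eq_zero]
  refine eq_zero_of_degree_lt_of_eval_finset_eq_zero (subfieldUnits K q) ?_ fun x hx => ?_
  · rw [card_subfieldUnits hcard, ← hd1]
    exact degree_sub_lt_left (hd1.trans hd2.symm) hm1.ne_zero (by
      rw [hm1.leadingCoeff, hm2.leadingCoeff])
  · have h1 := mem_subfieldUnits.mp hx
    rw [eval_sub, eval_prod, Finset.prod_eq_zero hx (by simp)]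
    simp [(pow_sub_one_eq_one_iff (by omega) h1.1).mpr h1.2]

lemma prod_sub_mul_subfieldUnits (hcard : Fintype.card K = q ^ 2) (x : K) {c : K} (hc : c ≠ 0) :
    x * ∏ f ∈ subfieldUnits K q, (x - c * f) = x ^ q - c ^ (q - 1) * x := by
  have hq := one_lt_of_card_eq_sq hcard
  have h1 := congrArg (Polynomial.eval (x / c)) (prod_X_sub_C_subfieldUnits hcard)
  simp only [Polynomial.eval_prod, Polynomial.eval_sub, Polynomial.eval_X, Polynomial.eval_C,
    Polynomial.eval_pow, Polynomial.eval_one] at h1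
  have h2 : ∏ f ∈ subfieldUnits K q, (x - c * f) =
      c ^ (q - 1) * ∏ f ∈ subfieldUnits K q, (x / c - f) := by
    rw [← card_subfieldUnits hcard, ← Finset.prod_const, ← Finset.prod_mul_distrib]
    refine Finset.prod_congr rfl fun f _ => ?_
    field_simp
  obtain ⟨r, rfl⟩ : ∃ r, q = r + 1 := ⟨q - 1, by omega⟩
  rw [h2, h1, Nat.add_sub_cancel, div_pow]
  have := pow_ne_zero r hc
  field_simp
  ring

lemma prod_subfieldUnits (hcard : Fintype.card K = q ^ 2) : ∏ f ∈ subfieldUnits K q, f = -1 := by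
  have hq := one_lt_of_card_eq_sq hcard
  have h1 := congrArg (Polynomial.eval 0) (prod_X_sub_C_subfieldUnits hcard)
  simp only [Polynomial.eval_prod, Polynomial.eval_sub, Polynomial.eval_X, Polynomial.eval_C,
    Polynomial.eval_pow, Polynomial.eval_one, zero_sub, zero_pow (show q - 1 ≠ 0 by omega)] at h1
  rw [Finset.prod_neg, card_subfieldUnits hcard,
    (pow_sub_one_eq_one_iff (by omega) (neg_ne_zero.mpr one_ne_zero)).mpr (neg_one_pow_q hcard),
    one_mul] at h1
  exact h1

end Norm

/-! ### Jacobi sums and Teichmüller characters -/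

section JacobiSums

variable {K R : Type*} [Field K] [Fintype K] [CommRing R]

lemma sum_mulChar_mul_mulChar_sub (a b : MulChar K R) {s : K} (hs : s ≠ 0) :
    ∑ x, a x * b (s - x) = (a * b) s * jacobiSum a b := by
  rw [jacobiSum, Finset.mul_sum, ← Equiv.sum_comp (Equiv.mulLeft₀ s hs)]
  refine Finset.sum_congr rfl fun x _ => ?_
  rw [Equiv.mulLeft₀_apply, show s - s * x = s * (1 - x) by ring, map_mul, map_mul,
    MulChar.mul_apply]
  ring

lemma sum_mulChar_mul_mulChar_sub' [IsDomain R] (a b : MulChar K R) (hab : a * b ≠ 1) (s : K) :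
    ∑ x, a x * b (s - x) = (a * b) s * jacobiSum a b := by
  rcases eq_or_ne s 0 with rfl | hs
  · rw [MulCharClass.map_nonunit _ not_isUnit_zero, zero_mul]
    have h : ∀ x, a x * b (0 - x) = b (-1) * (a * b) x := fun x => by
      rw [show (0 : K) - x = -1 * x by ring, map_mul, MulChar.mul_apply]; ring
    simp_rw [h, ← Finset.mul_sum, MulChar.sum_eq_zero_of_ne_one hab, mul_zero]
  · exact sum_mulChar_mul_mulChar_sub a b hs

/-- Both sides count the solutions of `x + y + z = 1` with weight `a x * b y * c z`. -/
lemma jacobiSum_mul_jacobiSum_mul [IsDomain R] (a b c : MulChar K R) (hab : a * b ≠ 1)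
    (hbc : b * c ≠ 1) :
    jacobiSum a b * jacobiSum (a * b) c = jacobiSum b c * jacobiSum a (b * c) := by
  have h1 : jacobiSum a b * jacobiSum (a * b) c = ∑ s, ∑ x, a x * b (s - x) * c (1 - s) := by
    rw [show jacobiSum (a * b) c = ∑ s, (a * b) s * c (1 - s) from rfl, Finset.mul_sum]
    refine Finset.sum_congr rfl fun s _ => ?_
    rw [← Finset.sum_mul, sum_mulChar_mul_mulChar_sub' a b hab]
    ring
  have h2 : jacobiSum b c * jacobiSum a (b * c) = ∑ x, ∑ t, a x * b t * c (1 - x - t) := by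
    rw [show jacobiSum a (b * c) = ∑ x, a x * (b * c) (1 - x) from rfl, Finset.mul_sum]
    refine Finset.sum_congr rfl fun x _ => ?_
    simp_rw [mul_assoc, ← Finset.mul_sum, sum_mulChar_mul_mulChar_sub' b c hbc]
    ring
  rw [h1, h2, Finset.sum_comm]
  refine Finset.sum_congr rfl fun x _ => ?_
  rw [← Equiv.sum_comp (Equiv.addLeft x)]
  refine Finset.sum_congr rfl fun t _ => ?_
  simp only [Equiv.coe_addLeft]
  rw [show x + t - x = t by ring, show 1 - (x + t) = 1 - x - t by ring]

lemma jacobiSum_mul_inv_inv (ν e : MulChar K R) (hν : ν (-1) = 1) :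
    jacobiSum (ν * e⁻¹) ν⁻¹ = jacobiSum e ν⁻¹ := by
  rw [jacobiSum, jacobiSum, ← Equiv.sum_comp (Equiv.inv K)]
  refine Finset.sum_congr rfl fun x _ => ?_
  rcases eq_or_ne x 0 with rfl | hx
  · simp [MulChar.map_zero]
  · have h1 : (1 : K) - x⁻¹ = -1 * ((1 - x) * x⁻¹) := by field_simp; ring
    have h2 : ν x⁻¹ * ν x = 1 := by rw [← map_mul, inv_mul_cancel₀ hx, map_one]
    simp only [Equiv.inv_apply, MulChar.mul_apply, h1, map_mul, MulChar.inv_apply', inv_inv,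
      inv_neg, inv_one, hν]
    linear_combination e x * ν (1 - x)⁻¹ * h2

/-- `χ` is the multiplicative section of the reduction map `red`, whose kernel is generated by `p`:
the Teichmüller character of the ring of Witt vectors of `K`. -/
structure IsTeichmuller (p : ℕ) (χ : MulChar K R) (red : R →+* K) : Prop where
  red_apply : ∀ x, red (χ x) = x
  dvd_of_red_eq_zero : ∀ a, red a = 0 → (p : R) ∣ a

variable {p q : ℕ} {χ : MulChar K R} {red : R →+* K}

lemma IsTeichmuller.pow_ne_one (hχ : IsTeichmuller p χ red) {n : ℕ} (hn : 0 < n)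
    (hn' : n < Fintype.card K - 1) : χ ^ n ≠ 1 := by
  classical
  intro h
  obtain ⟨g, hg⟩ := IsCyclic.exists_generator (α := Kˣ)
  have hgo := orderOf_eq_card_of_forall_mem_zpowers hg
  rw [Nat.card_eq_fintype_card, Fintype.card_units] at hgo
  have h1 : (g : K) ^ n = 1 := by
    have := congrArg red (congrArg (fun c : MulChar K R => c (g : K)) h)
    simpa [MulChar.pow_apply' χ hn.ne', hχ.red_apply] using this
  have h2 : g ^ n = 1 := Units.ext (by simpa using h1)
  have := Nat.le_of_dvd hn (orderOf_dvd_of_pow_eq_one h2)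
  omega

/-- The congruence `χ (1 - x) ≡ 1 - χ x` modulo `p` improves to `p ^ (v + 1)` after raising to a
power divisible by `p ^ v`; expanding, only the linear term survives the sum. -/
lemma IsTeichmuller.dvd_jacobiSum_inv_pow_sub [IsDomain R] (hχ : IsTeichmuller p χ red) {v c : ℕ}
    (hc : 0 < c) (hcK : c < Fintype.card K) (hK : 2 < Fintype.card K)
    (hv : p ^ v ∣ c) (hpK : (p : R) ^ (v + 1) ∣ (Fintype.card K : R)) :
    (p : R) ^ (v + 1) ∣ jacobiSum χ⁻¹ (χ ^ c) - c := by
  classical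
  have hpow : ∀ x : K, (p : R) ^ (v + 1) ∣ χ (1 - x) ^ c - (1 - χ x) ^ c := by
    intro x
    obtain ⟨d, rfl⟩ := hv
    rw [pow_mul, pow_mul]
    refine dvd_trans ?_ (sub_dvd_pow_sub_pow _ _ d)
    apply dvd_sub_pow_of_dvd_sub
    apply hχ.dvd_of_red_eq_zero
    simp [hχ.red_apply]
  have hsum : ∑ x, χ⁻¹ x * (1 - χ x) ^ c = (c : R) - Fintype.card K * c := by
    have h1 : ∀ x, χ⁻¹ x * (1 - χ x) ^ c =
        ∑ k ∈ Finset.range (c + 1), (-1) ^ k * (c.choose k : R) * (χ⁻¹ x * χ x ^ k) := by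
      intro x
      rw [show (1 : R) - χ x = -χ x + 1 by ring, add_pow, Finset.mul_sum]
      refine Finset.sum_congr rfl fun k _ => ?_
      rw [neg_pow]; ring
    simp_rw [h1]
    rw [Finset.sum_comm]
    simp_rw [← Finset.mul_sum]
    rw [Finset.sum_eq_single 1]
    · have h2 : ∀ x : K, χ⁻¹ x * χ x ^ 1 = (1 : MulChar K R) x := fun x => by
        rw [pow_one, ← MulChar.mul_apply, inv_mul_cancel]
      simp_rw [h2]
      rw [MulChar.sum_one_eq_card_units, Fintype.card_units, Nat.cast_sub (by omega)]
      simp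
      ring
    · intro k hk hk1
      rw [Finset.mem_range] at hk
      have h3 : ∑ x, χ⁻¹ x * χ x ^ k = 0 := by
        rcases Nat.eq_zero_or_pos k with rfl | hk0
        · simp only [pow_zero, mul_one]
          apply MulChar.sum_eq_zero_of_ne_one
          rw [Ne, inv_eq_one]
          simpa using hχ.pow_ne_one (n := 1) one_pos (by omega)
        · have h4 : ∀ x, χ⁻¹ x * χ x ^ k = (χ ^ (k - 1)) x := fun x => by
            rw [← MulChar.pow_apply' χ hk0.ne', ← MulChar.mul_apply]
            congr 1
            rw [inv_mul_eq_iff_eq_mul, ← pow_succ']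
            congr 1; omega
          simp_rw [h4]
          exact MulChar.sum_eq_zero_of_ne_one (hχ.pow_ne_one (by omega) (by omega))
      rw [h3, mul_zero]
    · intro h; exact absurd (Finset.mem_range.mpr (by omega)) h
  have h5 : jacobiSum χ⁻¹ (χ ^ c) - c =
      ∑ x, χ⁻¹ x * (χ (1 - x) ^ c - (1 - χ x) ^ c) - Fintype.card K * c := by
    simp_rw [mul_sub, Finset.sum_sub_distrib]
    rw [hsum, jacobiSum]
    simp_rw [MulChar.pow_apply' χ hc.ne']
    ring
  rw [h5]
  exact dvd_sub (Finset.dvd_sum fun x _ => (hpow x).mul_left _) (hpK.mul_right _)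

lemma jacobiSum_inv_pow_frobenius {h : ℕ} [Fact p.Prime] [CharP K p] (hq : q = p ^ h)
    (hcard : Fintype.card K = q ^ 2) {s t : ℕ} (hst : 0 < t) (hs : 0 < s) :
    jacobiSum (χ ^ q)⁻¹ (χ ^ (s + q * t)) = jacobiSum χ⁻¹ (χ ^ (t + q * s)) := by
  have hq0 : q ≠ 0 := by rintro rfl; simp at hcard
  have hfr := pow_q_pow_q hcard
  let σ : K ≃ K := ⟨fun x => x ^ q, fun x => x ^ q, hfr, hfr⟩
  rw [jacobiSum, jacobiSum, ← Equiv.sum_comp σ]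
  refine Finset.sum_congr rfl fun x _ => ?_
  have h1 : (1 : K) - x ^ q = (1 - x) ^ q := by
    rw [hq, sub_pow_char_pow, one_pow]
  have h2 : (χ ^ q)⁻¹ (x ^ q) = χ⁻¹ x := by
    rw [MulChar.inv_apply', MulChar.inv_apply', MulChar.pow_apply' χ hq0, ← map_pow, ← inv_pow, hfr]
  have h3 : (χ ^ (s + q * t)) ((1 - x) ^ q) = (χ ^ (t + q * s)) (1 - x) := by
    rw [MulChar.pow_apply' χ (by omega), MulChar.pow_apply' χ (by omega), ← map_pow, ← map_pow]
    congr 1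
    rw [pow_add, pow_add, pow_mul, hfr, mul_comm, ← pow_mul]
  change (χ ^ q)⁻¹ (x ^ q) * (χ ^ (s + q * t)) (1 - x ^ q) = _
  rw [h1, h2, h3]

/-- The character sums of `f` against the norms of `w - β` are divisible by `q`. For the functions
attached to a unital this says that the lines through a fixed point meet the unital in `1` modulo
`q` points. -/
def NormSumsDvd (q : ℕ) (χ : MulChar K R) (f : K → K) : Prop :=
  ∀ β : K, (q : R) ∣ ∑ w, χ⁻¹ ((w - β) ^ (q + 1)) * χ (f w)

/-- The coefficient of `w ^ (s + q * t)` in the polynomial representing `f` vanishes. The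
hypothesis on `f`, multiplied by a character and summed, reads `q ∣ J * B` with a Jacobi sum `J`
and a lift `B` of the coefficient. By the product formula a multiple of `J` is a product of two
Jacobi sums which are congruent to `t + q * s` and to `s`. As `t < q`, the exact power of `p` in
the former is smaller than `q`, which forces `p ∣ B`. -/
theorem NormSumsDvd.coeff_eq_zero [IsDomain R] {h : ℕ} [Fact p.Prime] [CharP K p] (hq : q = p ^ h)
    (hcard : Fintype.card K = q ^ 2) (hq2 : 2 < q) (hχ : IsTeichmuller p χ red) (hp0 : (p : R) ≠ 0)
    {f : K → K} (hf0 : f 0 = 0) (hf : NormSumsDvd q χ f) {s t : ℕ} (hs : ¬ p ∣ s) (hsq : s < q)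
    (ht : 0 < t) (htq : t < q) : ∑ w, (w⁻¹) ^ (s + q * t) * f w = 0 := by
  have hp : p.Prime := Fact.out
  have hs0 : 0 < s := Nat.pos_of_ne_zero fun h0 => hs (h0 ▸ dvd_zero p)
  set e := s + q * t with he
  set ν := χ ^ (q + 1) with hν
  have hνpow : ∀ x : K, χ⁻¹ (x ^ (q + 1)) = ν⁻¹ x := fun x => by
    rw [MulChar.inv_apply', MulChar.inv_apply', hν, MulChar.pow_apply' χ (by omega), ← inv_pow,
      map_pow]
  have hν1 : ν (-1) = 1 := by
    rw [hν, MulChar.pow_apply' χ (by omega), ← map_pow]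
    rw [neg_one_pow_q_add_one hcard, map_one]
  -- multiply the hypothesis by a character of `β` and sum
  have hA : (q : R) ∣ jacobiSum (χ ^ e) ν⁻¹ * ∑ w, (χ ^ e)⁻¹ w * χ (f w) := by
    have h1 : ∑ β, (ν * (χ ^ e)⁻¹) β * ∑ w, χ⁻¹ ((w - β) ^ (q + 1)) * χ (f w) =
        jacobiSum (χ ^ e) ν⁻¹ * ∑ w, (χ ^ e)⁻¹ w * χ (f w) := by
      simp_rw [Finset.mul_sum]
      rw [Finset.sum_comm]
      refine Finset.sum_congr rfl fun w _ => ?_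
      rcases eq_or_ne w 0 with rfl | hw
      · simp [hf0, MulChar.map_zero]
      · simp_rw [hνpow, ← mul_assoc, ← Finset.sum_mul]
        rw [sum_mulChar_mul_mulChar_sub _ _ hw, jacobiSum_mul_inv_inv _ _ hν1]
        rw [mul_right_comm ν, mul_inv_cancel, one_mul]
        ring
    rw [← h1]
    exact Finset.dvd_sum fun β _ => (hf β).mul_left _
  -- `v` is the exact exponent of `p` in `t`
  obtain ⟨v, t', ht', htv⟩ := Nat.exists_eq_pow_mul_and_not_dvd ht.ne' p hp.ne_one
  have hvh : v < h := by
    have h1 : p ^ v ≤ t := by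
      rw [htv]
      exact Nat.le_mul_of_pos_right _ (Nat.pos_of_ne_zero fun h0 => ht' (h0 ▸ dvd_zero p))
    exact (Nat.pow_lt_pow_iff_right hp.one_lt).mp (by omega)
  have hqR : ∀ k, k ≤ h → (p : R) ^ k ∣ (q : R) := fun k hk => by
    rw [hq, Nat.cast_pow]; exact pow_dvd_pow _ hk
  have hcR : ∀ k, k ≤ h → (p : R) ^ k ∣ (Fintype.card K : R) := fun k hk => by
    rw [hcard, pow_two, Nat.cast_mul]; exact (hqR k hk).mul_right _
  have hqq : q * q ≤ Fintype.card K := by rw [hcard, pow_two]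
  have hbound : ∀ a b : ℕ, a < q → b < q → a + q * b < Fintype.card K := fun a b ha hb => by
    have : q * (b + 1) ≤ q * q := Nat.mul_le_mul_left _ hb
    rw [mul_add] at this
    omega
  have h3q : 3 * q ≤ q * q := Nat.mul_le_mul_right _ hq2
  -- the product formula
  have htri : jacobiSum (χ)⁻¹ (χ ^ q)⁻¹ * jacobiSum (χ ^ e) ν⁻¹ =
      jacobiSum χ⁻¹ (χ ^ (t + q * s)) * jacobiSum χ⁻¹ (χ ^ (s + q * (t - 1))) := by
    have h1 : (χ)⁻¹ * (χ ^ q)⁻¹ = ν⁻¹ := by rw [hν, ← mul_inv, ← pow_succ']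
    have h2 : (χ ^ q)⁻¹ * χ ^ e = χ ^ (s + q * (t - 1)) := by
      rw [inv_mul_eq_iff_eq_mul, ← pow_add]
      congr 1
      obtain ⟨t, rfl⟩ : ∃ r, t = r + 1 := ⟨t - 1, by omega⟩
      rw [he, Nat.add_sub_cancel]; ring
    have h3 := jacobiSum_mul_jacobiSum_mul (χ)⁻¹ (χ ^ q)⁻¹ (χ ^ e) (by
      rw [h1, Ne, inv_eq_one]; exact hχ.pow_ne_one (by omega) (by omega)) (by
      rw [h2]
      refine hχ.pow_ne_one (by omega) ?_
      have := hbound s (t - 1 + 1) hsq (by omega)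
      rw [mul_add] at this
      omega)
    rw [h1, h2, jacobiSum_inv_pow_frobenius hq hcard ht hs0, jacobiSum_comm ν⁻¹] at h3
    exact h3
  set B := ∑ w, (χ ^ e)⁻¹ w * χ (f w) with hB
  have hdiv : (p : R) ^ (v + 1) ∣
      jacobiSum χ⁻¹ (χ ^ (t + q * s)) * jacobiSum χ⁻¹ (χ ^ (s + q * (t - 1))) * B := by
    rw [← htri, mul_assoc]
    exact ((hqR (v + 1) hvh).trans hA).mul_left _
  have hJ1 := hχ.dvd_jacobiSum_inv_pow_sub (v := v) (c := t + q * s) (by omega)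
    (hbound t s htq hsq) (by omega)
    (dvd_add ⟨t', htv⟩ (((hq ▸ pow_dvd_pow p hvh.le : p ^ v ∣ q)).mul_right _)) (hcR _ hvh)
  have hJ2 := hχ.dvd_jacobiSum_inv_pow_sub (v := 0) (c := s + q * (t - 1)) (by omega)
    (hbound s (t - 1) hsq (by omega)) (by omega) (by simp) (hcR _ (by omega))
  rw [zero_add, pow_one] at hJ2
  obtain ⟨r, hr⟩ := hJ1
  obtain ⟨m, hm⟩ : p ∣ q / p ^ v := by
    rw [hq, Nat.pow_div hvh.le hp.pos]; exact dvd_pow_self p (by omega)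
  have hqv : q = p ^ v * (p * m) := by
    rw [← hm, Nat.mul_div_cancel' (hq ▸ pow_dvd_pow p hvh.le : p ^ v ∣ q)]
  have hJ1' : jacobiSum χ⁻¹ (χ ^ (t + q * s)) = (p : R) ^ v * (t' + p * (m * s + r)) := by
    rw [sub_eq_iff_eq_add.mp hr]
    have : ((t + q * s : ℕ) : R) = (p : R) ^ v * t' + (p : R) ^ v * (p * m) * s := by
      rw [Nat.cast_add, Nat.cast_mul, hqv]; conv_lhs => rw [htv]
      push_cast; ring
    rw [this]; ring
  rw [hJ1', pow_succ, mul_assoc, mul_assoc] at hdiv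
  have hdiv' := (mul_dvd_mul_iff_left (pow_ne_zero v hp0)).mp hdiv
  have hredp : ∀ a : R, (p : R) ∣ a → red a = 0 := by
    rintro a ⟨b, rfl⟩
    rw [map_mul, map_natCast, CharP.cast_eq_zero, zero_mul]
  have hzero := hredp _ hdiv'
  have hJ2' := hredp _ hJ2
  rw [map_sub, sub_eq_zero] at hJ2'
  have hcast : ∀ n : ℕ, ¬ p ∣ n → (n : K) ≠ 0 :=
    fun n hn h0 => hn ((CharP.cast_eq_zero_iff K p n).mp h0)
  have hB0 : red B = 0 := by
    rw [map_mul, map_mul, hJ2', map_add, map_mul, map_natCast, map_natCast, map_natCast,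
      CharP.cast_eq_zero K p, zero_mul, add_zero] at hzero
    rcases mul_eq_zero.mp hzero with h1 | h1
    · exact absurd h1 (hcast _ ht')
    rcases mul_eq_zero.mp h1 with h1 | h1
    · refine absurd h1 (hcast _ fun hd => hs ?_)
      exact (Nat.dvd_add_left ((hq ▸ dvd_pow_self p (by omega) : p ∣ q).mul_right _)).mp hd
    · exact h1
  rw [hB, map_sum] at hB0
  rw [← hB0]
  refine Finset.sum_congr rfl fun w _ => ?_
  rw [map_mul, hχ.red_apply, MulChar.inv_apply', MulChar.pow_apply' χ (by omega), map_pow,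
    hχ.red_apply]

end JacobiSums

/-! ### Functions describing a unital, and their tangent values -/

open Classical in
lemma ncard_eq_card_filter {α : Type*} [Fintype α] (P : α → Prop) :
    {w | P w}.ncard = (Finset.univ.filter P).card := by
  rw [Set.ncard_eq_toFinset_card', Set.toFinset_ofPred]

/-- The properties of the function `ψ` for which a unital invariant under a group of
`q ^ 2 - 1` diagonal collineations is given by the equation `y ^ (q + 1) = ψ w` in the affine plane
of points `(1 : y : w)`. The zeros of `ψ` are the multiples of `c` by elements of the subfield with
`q` elements. -/
structure IsUnitalFunction {K : Type*} [Field K] (q : ℕ) (c : K) (ψ : K → K) : Prop where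
  ne_zero : c ≠ 0
  pow_q : ∀ w, ψ w ^ q = ψ w
  eq_zero_iff : ∀ w, ψ w = 0 ↔ ∃ f, f ^ q = f ∧ w = c * f
  card_fiber : ∀ n, n ≠ 0 → n ^ q = n → {w | ψ w = n}.ncard = q
  card_norm_fiber : ∀ n, n ≠ 0 → n ^ q = n → {w | w ≠ 0 ∧ ψ w = n * w ^ (q + 1)}.ncard = q
  card_line : ∀ α γ, α ≠ 0 → γ ≠ 0 →
    {w | (α + γ * w) ^ (q + 1) = ψ w}.ncard = 1 ∨ {w | (α + γ * w) ^ (q + 1) = ψ w}.ncard = q + 1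
  homogeneous : ∀ l, l ≠ 0 → l ^ q = l → ∃ m, ∀ w, ψ (l * w) = m * ψ w

namespace IsUnitalFunction

open Finset Classical

variable {K : Type*} [Field K] [Fintype K] {q : ℕ} {c : K} {ψ : K → K}

lemma map_zero (hψ : IsUnitalFunction q c ψ) (hcard : Fintype.card K = q ^ 2) : ψ 0 = 0 :=
  (hψ.eq_zero_iff 0).mpr
    ⟨0, zero_pow (by have := one_lt_of_card_eq_sq hcard; omega), by simp⟩

lemma mem_subfieldUnits (hψ : IsUnitalFunction q c ψ) {w : K} (hw : ψ w ≠ 0) :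
    ψ w ∈ subfieldUnits K q :=
  _root_.mem_subfieldUnits.mpr ⟨hw, hψ.pow_q w⟩

/-- The points `w` outside the zero set of `ψ` with `(w - β) ^ (q + 1) = l * ψ w`.
If `g ^ (q + 1) = l⁻¹`, then these correspond to the points of the unital `y ^ (q + 1) = ψ w` on
the line `y = g * (w - β)`, apart from `(1 : 0 : β)`. -/
noncomputable def sphere (q : ℕ) (ψ : K → K) (β l : K) : Finset K :=
  univ.filter fun w => ψ w ≠ 0 ∧ (w - β) ^ (q + 1) = l * ψ w

lemma filter_eq_zero (hψ : IsUnitalFunction q c ψ) (hcard : Fintype.card K = q ^ 2) :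
    (univ.filter fun w => ψ w = 0) = (insert 0 (subfieldUnits K q)).image (c * ·) := by
  have hq := one_lt_of_card_eq_sq hcard
  ext w
  simp only [mem_filter, mem_univ, true_and, mem_image, mem_insert, _root_.mem_subfieldUnits,
    hψ.eq_zero_iff]
  constructor
  · rintro ⟨f, hf, rfl⟩
    exact ⟨f, by tauto, rfl⟩
  · rintro ⟨f, rfl | hf, rfl⟩
    · exact ⟨0, zero_pow (by omega), rfl⟩
    · exact ⟨f, hf.2, rfl⟩

lemma card_zeros (hψ : IsUnitalFunction q c ψ) (hcard : Fintype.card K = q ^ 2) :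
    (univ.filter fun w => ψ w = 0).card = q := by
  have hq := one_lt_of_card_eq_sq hcard
  rw [hψ.filter_eq_zero hcard, card_image_of_injective _ (mul_right_injective₀ hψ.ne_zero),
    card_insert_of_notMem (by simp), card_subfieldUnits hcard]
  omega

lemma card_nonzeros (hψ : IsUnitalFunction q c ψ) (hcard : Fintype.card K = q ^ 2) :
    (univ.filter fun w => ψ w ≠ 0).card = q * (q - 1) := by
  have h1 := card_filter_add_card_filter_not (s := (univ : Finset K)) (fun w => ψ w = 0)
  rw [hψ.card_zeros hcard, card_univ, hcard] at h1
  have h2 : q ^ 2 = q * (q - 1) + q := by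
    have := one_lt_of_card_eq_sq hcard
    obtain ⟨r, rfl⟩ : ∃ r, q = r + 1 := ⟨q - 1, by omega⟩
    rw [Nat.add_sub_cancel]
    ring
  rw [h2, add_comm] at h1
  exact Nat.add_right_cancel h1

lemma div_mem_subfieldUnits (hψ : IsUnitalFunction q c ψ) (hcard : Fintype.card K = q ^ 2)
    {w β : K} (hw : ψ w ≠ 0) (hwβ : w ≠ β) : (w - β) ^ (q + 1) / ψ w ∈ subfieldUnits K q :=
  _root_.div_mem_subfieldUnits (norm_mem_subfieldUnits hcard (sub_ne_zero.mpr hwβ))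
    (hψ.mem_subfieldUnits hw)

lemma filter_div_eq_sphere {β l : K} (hl : l ≠ 0) :
    ((univ.filter fun w => ψ w ≠ 0 ∧ w ≠ β).filter fun w => (w - β) ^ (q + 1) / ψ w = l) =
      sphere q ψ β l := by
  ext w
  simp only [sphere, mem_filter, mem_univ, true_and]
  constructor
  · rintro ⟨⟨h1, h2⟩, h3⟩
    exact ⟨h1, (div_eq_iff h1).mp h3⟩
  · rintro ⟨h1, h3⟩
    refine ⟨⟨h1, ?_⟩, (div_eq_iff h1).mpr h3⟩
    rintro rfl
    rw [sub_self, zero_pow (by omega)] at h3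
    exact mul_ne_zero hl h1 h3.symm

lemma sum_card_sphere (hψ : IsUnitalFunction q c ψ) (hcard : Fintype.card K = q ^ 2) (β : K) :
    ∑ l ∈ subfieldUnits K q, (sphere q ψ β l).card =
      (univ.filter fun w => ψ w ≠ 0 ∧ w ≠ β).card := by
  rw [card_eq_sum_card_fiberwise (f := fun w => (w - β) ^ (q + 1) / ψ w)
    (t := subfieldUnits K q)]
  · refine sum_congr rfl fun l hl => ?_
    rw [filter_div_eq_sphere (_root_.mem_subfieldUnits.mp hl).1]
  · intro w hw
    simp only [coe_filter, mem_univ, true_and, Set.mem_ofPred_eq] at hw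
    exact hψ.div_mem_subfieldUnits hcard hw.1 hw.2

lemma card_line_eq (hψ : IsUnitalFunction q c ψ) (hcard : Fintype.card K = q ^ 2) {β l : K}
    (hβ : β ≠ 0) (hl : l ∈ subfieldUnits K q) :
    (univ.filter fun w => (w - β) ^ (q + 1) = l * ψ w).card = 1 ∨
      (univ.filter fun w => (w - β) ^ (q + 1) = l * ψ w).card = q + 1 := by
  obtain ⟨γ, hγ, hγl⟩ := exists_pow_q_add_one_eq hcard (inv_mem_subfieldUnits hl)
  have hl0 := (_root_.mem_subfieldUnits.mp hl).1
  have h := hψ.card_line (-(γ * β)) γ (neg_ne_zero.mpr (mul_ne_zero hγ hβ)) hγ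
  have h1 : {w | (-(γ * β) + γ * w) ^ (q + 1) = ψ w} = {w | (w - β) ^ (q + 1) = l * ψ w} := by
    ext w
    rw [Set.mem_ofPred_eq, Set.mem_ofPred_eq, show -(γ * β) + γ * w = γ * (w - β) by ring, mul_pow,
      hγl, inv_mul_eq_iff_eq_mul₀ hl0]
  rwa [h1, ncard_eq_card_filter] at h

lemma card_sphere_of_eq_zero (hψ : IsUnitalFunction q c ψ) (hcard : Fintype.card K = q ^ 2)
    {β l : K} (hβ : ψ β = 0) (hl : l ∈ subfieldUnits K q) : (sphere q ψ β l).card = q := by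
  have hq := one_lt_of_card_eq_sq hcard
  have hl' := _root_.mem_subfieldUnits.mp hl
  rcases eq_or_ne β 0 with rfl | hβ0
  · have h1 := _root_.mem_subfieldUnits.mp (inv_mem_subfieldUnits hl)
    have h := hψ.card_norm_fiber l⁻¹ h1.1 h1.2
    rw [ncard_eq_card_filter] at h
    refine Eq.trans (congrArg card ?_) h
    ext w
    simp only [sphere, mem_filter, mem_univ, true_and, sub_zero, eq_inv_mul_iff_mul_eq₀ hl'.1]
    constructor
    · rintro ⟨h2, h3⟩
      refine ⟨?_, h3.symm⟩
      rintro rfl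
      exact h2 (hψ.map_zero hcard)
    · rintro ⟨h2, h3⟩
      refine ⟨?_, h3.symm⟩
      intro h4
      rw [h4, mul_zero] at h3
      exact pow_ne_zero _ h2 h3.symm
  · -- each of the `q - 1` spheres has `0` or `q` points, and together they have `q * (q - 1)`
    have key : ∀ m ∈ subfieldUnits K q, (sphere q ψ β m).card ≤ q := by
      intro m hm
      have h1 : (sphere q ψ β m).card + 1 =
          (univ.filter fun w => (w - β) ^ (q + 1) = m * ψ w).card := by
        rw [← card_insert_of_notMem (a := β) (by simp [sphere, hβ])]
        congr 1
        ext w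
        simp only [sphere, mem_insert, mem_filter, mem_univ, true_and]
        constructor
        · rintro (rfl | h)
          · simp [hβ]
          · exact h.2
        · intro h
          by_cases hw : ψ w = 0
          · left
            rw [hw, mul_zero] at h
            exact sub_eq_zero.mp (pow_eq_zero_iff (by omega) |>.mp h)
          · exact Or.inr ⟨hw, h⟩
      rcases hψ.card_line_eq hcard hβ0 hm with h | h <;> omega
    have hsum := hψ.sum_card_sphere hcard β
    have h2 : (univ.filter fun w => ψ w ≠ 0 ∧ w ≠ β) = univ.filter fun w => ψ w ≠ 0 := by
      ext w
      simp only [mem_filter, mem_univ, true_and, and_iff_left_iff_imp]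
      rintro h rfl
      exact h hβ
    rw [h2, hψ.card_nonzeros hcard, mul_comm, ← card_subfieldUnits hcard, ← smul_eq_mul,
      ← sum_const, sum_eq_sum_iff_of_le key] at hsum
    exact hsum l hl

/-- Counting the points outside the zero set shows that exactly one sphere is exceptional. -/
lemma exists_tangent_value (hψ : IsUnitalFunction q c ψ) (hcard : Fintype.card K = q ^ 2)
    {β : K} (hβ : ψ β ≠ 0) : ∃ t ∈ subfieldUnits K q, (sphere q ψ β t).card = 1 ∧
      ∀ l ∈ subfieldUnits K q, l ≠ t → (sphere q ψ β l).card = q + 1 := by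
  have hq := one_lt_of_card_eq_sq hcard
  have hβ0 : β ≠ 0 := by rintro rfl; exact hβ (hψ.map_zero hcard)
  have key : ∀ m ∈ subfieldUnits K q,
      (sphere q ψ β m).card = 1 ∨ (sphere q ψ β m).card = q + 1 := by
    intro m hm
    have h1 : sphere q ψ β m = univ.filter fun w => (w - β) ^ (q + 1) = m * ψ w := by
      ext w
      simp only [sphere, mem_filter, mem_univ, true_and, and_iff_right_iff_imp]
      intro h hw
      rw [hw, mul_zero] at h
      rw [← sub_eq_zero.mp (pow_eq_zero_iff (by omega) |>.mp h)] at hβ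
      exact hβ hw
    rw [h1]
    exact hψ.card_line_eq hcard hβ0 hm
  have hsum := hψ.sum_card_sphere hcard β
  have h2 : (univ.filter fun w => ψ w ≠ 0 ∧ w ≠ β) = (univ.filter fun w => ψ w ≠ 0).erase β := by
    ext w
    simp only [mem_filter, mem_univ, true_and, mem_erase]
    tauto
  rw [h2, card_erase_of_mem (by simpa using hβ), hψ.card_nonzeros hcard] at hsum
  have h3 : ∑ l ∈ subfieldUnits K q, (sphere q ψ β l).card + q *
      ((subfieldUnits K q).filter fun l => (sphere q ψ β l).card = 1).card =
      (q - 1) * (q + 1) := by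
    rw [← card_subfieldUnits hcard, ← smul_eq_mul (#(subfieldUnits K q)), ← sum_const, card_filter,
      mul_sum, ← sum_add_distrib]
    refine sum_congr rfl fun l hl => ?_
    rcases key l hl with h | h
    · rw [h, if_pos rfl]; omega
    · rw [h, if_neg (by omega)]; omega
  have h4 : ((subfieldUnits K q).filter fun l => (sphere q ψ β l).card = 1).card = 1 := by
    rw [hsum] at h3
    set k := ((subfieldUnits K q).filter fun l => (sphere q ψ β l).card = 1).card
    obtain ⟨r, rfl⟩ : ∃ r, q = r + 2 := ⟨q - 2, by omega⟩
    have e1 : r + 2 - 1 = r + 1 := rfl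
    rw [e1] at h3
    have e2 : (r + 2) * (r + 1) - 1 + 1 = (r + 2) * (r + 1) :=
      Nat.sub_add_cancel (Nat.mul_pos (by omega) (by omega))
    have e3 : (r + 2) * k = (r + 2) * 1 := by nlinarith
    exact Nat.eq_of_mul_eq_mul_left (by omega) e3
  obtain ⟨t, ht⟩ := card_eq_one.mp h4
  have ht' : t ∈ (subfieldUnits K q).filter fun l => (sphere q ψ β l).card = 1 := by
    rw [ht]; exact mem_singleton_self t
  refine ⟨t, (mem_filter.mp ht').1, (mem_filter.mp ht').2, fun l hl hlt => ?_⟩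
  refine (key l hl).resolve_left fun h => hlt ?_
  have : l ∈ (subfieldUnits K q).filter fun l => (sphere q ψ β l).card = 1 :=
    mem_filter.mpr ⟨hl, h⟩
  rwa [ht, mem_singleton] at this

/-- `θ` is the tangent function of `ψ`: among the lines through `(1 : 0 : β)` with the parameters
`l` of `sphere`, those with `l = θ β` are the tangents of the unital. If `(1 : 0 : β)` is itself a
point of the unital, there are none, and `θ β = 0`. -/
structure IsTangentFunction (q : ℕ) (ψ θ : K → K) : Prop where
  eq_zero : ∀ β, ψ β = 0 → θ β = 0
  mem : ∀ β, ψ β ≠ 0 → θ β ∈ subfieldUnits K q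
  card_sphere : ∀ β, ψ β ≠ 0 → (sphere q ψ β (θ β)).card = 1
  card_sphere_of_ne : ∀ β, ψ β ≠ 0 → ∀ l ∈ subfieldUnits K q, l ≠ θ β →
    (sphere q ψ β l).card = q + 1

lemma exists_isTangentFunction (hψ : IsUnitalFunction q c ψ) (hcard : Fintype.card K = q ^ 2) :
    ∃ θ : K → K, IsTangentFunction q ψ θ := by
  choose t h1 h2 h3 using fun (β : K) (hβ : ψ β ≠ 0) => hψ.exists_tangent_value hcard hβ
  refine ⟨fun β => if h : ψ β = 0 then 0 else t β h, fun β hβ => by simp [hβ], fun β hβ => ?_,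
    fun β hβ => ?_, fun β hβ l hl hlt => ?_⟩
  · simpa [hβ] using h1 β hβ
  · simpa [hβ] using h2 β hβ
  · exact h3 β hβ l hl (by simpa [hβ] using hlt)

end IsUnitalFunction

/-! ### The product formula and the character sums of a unital function -/

namespace IsUnitalFunction

open Finset Classical

section Product

variable {K : Type*} [Field K] [Fintype K] {q : ℕ} {c : K} {ψ θ : K → K}

lemma prod_norm_div_mul_tangent (hψ : IsUnitalFunction q c ψ) (hcard : Fintype.card K = q ^ 2)
    (hθ : IsTangentFunction q ψ θ) {β : K} (hβ : ψ β ≠ 0) :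
    (∏ w ∈ univ.filter fun w => ψ w ≠ 0 ∧ w ≠ β, (w - β) ^ (q + 1) / ψ w) * θ β = 1 := by
  have hθm := hθ.mem β hβ
  have hθ0 := (_root_.mem_subfieldUnits.mp hθm).1
  rw [← prod_fiberwise_of_maps_to' (g := fun w => (w - β) ^ (q + 1) / ψ w)
    (t := subfieldUnits K q) (fun w hw => hψ.div_mem_subfieldUnits hcard (mem_filter.mp hw).2.1
      (mem_filter.mp hw).2.2) (fun x => x)]
  have h1 : ∀ l ∈ subfieldUnits K q, (∏ w ∈ (univ.filter fun w => ψ w ≠ 0 ∧ w ≠ β).filter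
      (fun w => (w - β) ^ (q + 1) / ψ w = l), l) = l ^ (sphere q ψ β l).card := by
    intro l hl
    rw [filter_div_eq_sphere (_root_.mem_subfieldUnits.mp hl).1, prod_const]
  rw [prod_congr rfl h1, ← mul_prod_erase _ _ hθm, hθ.card_sphere β hβ]
  have h2 : ∀ l ∈ (subfieldUnits K q).erase (θ β), l ^ (sphere q ψ β l).card = l ^ (q + 1) := by
    intro l hl
    rw [hθ.card_sphere_of_ne β hβ l (mem_of_mem_erase hl) (ne_of_mem_erase hl)]
  rw [prod_congr rfl h2, pow_one, mul_comm, ← mul_assoc, ← pow_two]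
  have h3 := mul_prod_erase (subfieldUnits K q) (fun l => l ^ (q + 1)) hθm
  rw [prod_pow (subfieldUnits K q) (q + 1) fun l => l, prod_subfieldUnits hcard,
    neg_one_pow_q_add_one hcard, pow_succ,
    (_root_.mem_subfieldUnits.mp hθm).2, ← pow_two] at h3
  exact h3

lemma prod_apply (hψ : IsUnitalFunction q c ψ) (hcard : Fintype.card K = q ^ 2) :
    ∏ w ∈ univ.filter fun w => ψ w ≠ 0, ψ w = -1 := by
  rw [← prod_fiberwise_of_maps_to' (g := ψ) (t := subfieldUnits K q)
    (fun w hw => hψ.mem_subfieldUnits (mem_filter.mp hw).2) (fun x => x)]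
  have h1 : ∀ l ∈ subfieldUnits K q, (∏ w ∈ (univ.filter fun w => ψ w ≠ 0).filter
      (fun w => ψ w = l), l) = l ^ q := by
    intro l hl
    have hl' := _root_.mem_subfieldUnits.mp hl
    have h := hψ.card_fiber l hl'.1 hl'.2
    rw [ncard_eq_card_filter] at h
    rw [prod_const, filter_filter]
    congr 1
    refine Eq.trans (congrArg card ?_) h
    ext w
    simp only [mem_filter, mem_univ, true_and, and_iff_right_iff_imp]
    rintro rfl
    exact hl'.1
  rw [prod_congr rfl h1, prod_pow, prod_subfieldUnits hcard, neg_one_pow_q hcard]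

lemma prod_univ_erase_sub (β : K) : ∏ w ∈ univ.erase β, (w - β) = (-1 : K) := by
  have h := congrArg Units.val (FiniteField.prod_univ_units_id_eq_neg_one (K := K))
  rw [Units.coe_prod, Units.val_neg, Units.val_one] at h
  rw [← h]
  refine prod_bij' (fun w hw => Units.mk0 (w - β) (sub_ne_zero.mpr (ne_of_mem_erase hw)))
    (fun u _ => u + β) (by simp) (by simp) (by simp) (fun u _ => ?_) (by simp)
  ext
  simp

lemma prod_zeros_sub (hψ : IsUnitalFunction q c ψ) (hcard : Fintype.card K = q ^ 2) (β : K) :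
    (∏ w ∈ univ.filter fun w => ψ w = 0, (w - β)) ^ (q + 1) =
      (β ^ q - c ^ (q - 1) * β) ^ (q + 1) := by
  have hq := one_lt_of_card_eq_sq hcard
  rw [hψ.filter_eq_zero hcard, prod_image fun _ _ _ _ h => mul_right_injective₀ hψ.ne_zero h,
    prod_insert (by simp), ← prod_sub_mul_subfieldUnits hcard β hψ.ne_zero, mul_zero, zero_sub,
    mul_pow, mul_pow, neg_pow, neg_one_pow_q_add_one hcard, one_mul, ← prod_pow, ← prod_pow]
  congr 1
  refine prod_congr rfl fun f _ => ?_
  rw [← neg_sub, neg_pow, neg_one_pow_q_add_one hcard, one_mul]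

/-- The tangent values are determined by `ψ`: multiply the values `(w - β) ^ (q + 1) / ψ w` over
all `w` and compare with the cardinalities of the spheres. -/
theorem mul_tangent (hψ : IsUnitalFunction q c ψ) (hcard : Fintype.card K = q ^ 2)
    (hθ : IsTangentFunction q ψ θ) (β : K) :
    c ^ (q - 1) * (ψ β * θ β) = (β ^ q - c ^ (q - 1) * β) ^ 2 := by
  have hq := one_lt_of_card_eq_sq hcard
  have hc := hψ.ne_zero
  obtain ⟨r, hr⟩ : ∃ r, q = r + 1 := ⟨q - 1, by omega⟩
  have hr' : q - 1 = r := by omega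
  have hcq : c ^ (q - 1) * (c ^ (q - 1)) ^ q = 1 := by
    rw [← pow_succ', ← pow_mul, mul_comm, ← card_sq_sub_one hcard, Nat.card_eq_fintype_card,
      Fintype.card_units, FiniteField.pow_card_sub_one_eq_one c hc]
  by_cases hβ : ψ β = 0
  · obtain ⟨f, hf, rfl⟩ := (hψ.eq_zero_iff β).mp hβ
    have h : c ^ q = c ^ r * c := by rw [hr, pow_succ]
    rw [hβ, mul_pow, hf, hr', h]
    ring
  set M := β ^ q - c ^ (q - 1) * β with hM
  have hMq : c ^ (q - 1) * M ^ q = -M := by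
    rw [hM, sub_pow_q hcard, pow_q_pow_q hcard, mul_pow, mul_sub, ← mul_assoc, hcq]
    ring
  have h1 : (∏ w ∈ univ.filter fun w => ψ w ≠ 0 ∧ w ≠ β, (w - β) ^ (q + 1)) * M ^ (q + 1) = 1 := by
    rw [← hψ.prod_zeros_sub hcard, prod_pow, ← mul_pow]
    have : (univ.filter fun w => ψ w ≠ 0 ∧ w ≠ β) =
        (univ.erase β).filter fun w => ¬ ψ w = 0 := by
      ext w; simp [and_comm]
    have h0 : (univ.filter fun w => ψ w = 0) = (univ.erase β).filter fun w => ψ w = 0 := by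
      ext w
      simp only [mem_filter, mem_univ, true_and, mem_erase, and_true, iff_and_self]
      rintro h rfl
      exact hβ h
    rw [this, h0, mul_comm, prod_filter_mul_prod_filter_not, prod_univ_erase_sub,
      neg_one_pow_q_add_one hcard]
  have h2 : (∏ w ∈ univ.filter fun w => ψ w ≠ 0 ∧ w ≠ β, ψ w) * ψ β = -1 := by
    rw [← hψ.prod_apply hcard, ← prod_erase_mul (univ.filter fun w => ψ w ≠ 0) ψ (a := β)
      (by simpa using hβ)]
    congr 2
    ext w
    simp [and_comm]
  have h3 := hψ.prod_norm_div_mul_tangent hcard hθ hβ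
  rw [prod_div_distrib] at h3
  set A := ∏ w ∈ univ.filter fun w => ψ w ≠ 0 ∧ w ≠ β, (w - β) ^ (q + 1)
  set B := ∏ w ∈ univ.filter fun w => ψ w ≠ 0 ∧ w ≠ β, ψ w
  have hB : B ≠ 0 := by rintro h; rw [h, zero_mul] at h2; simp at h2
  rw [div_mul_eq_mul_div, div_eq_one_iff_eq hB] at h3
  have h4 : ψ β * θ β = -M ^ (q + 1) := by
    linear_combination (-(ψ β * θ β)) * h1 + (ψ β * M ^ (q + 1)) * h3 + M ^ (q + 1) * h2
  rw [h4]
  linear_combination (-M) * hMq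

end Product

section Characters

variable {K R : Type*} [Field K] [Fintype K] [CommRing R] {q : ℕ} {c : K} {ψ θ : K → K}

lemma sum_subfieldUnits_mulChar [IsDomain R] (hcard : Fintype.card K = q ^ 2) {ρ : MulChar K R}
    (hρ : ρ ^ (q + 1) ≠ 1) : ∑ l ∈ subfieldUnits K q, ρ l = 0 := by
  obtain ⟨u, hu⟩ := MulChar.ne_one_iff.mp hρ
  rw [MulChar.pow_apply' ρ (by omega), ← map_pow] at hu
  have hu0 := norm_mem_subfieldUnits hcard u.ne_zero
  have hu1 := _root_.mem_subfieldUnits.mp hu0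
  have h : ρ ((u : K) ^ (q + 1)) * ∑ l ∈ subfieldUnits K q, ρ l = ∑ l ∈ subfieldUnits K q, ρ l := by
    rw [mul_sum]
    refine sum_bij' (fun l _ => (u : K) ^ (q + 1) * l) (fun l _ => l / (u : K) ^ (q + 1))
      ?_ ?_ ?_ ?_ ?_
    · intro l hl
      have hl' := _root_.mem_subfieldUnits.mp hl
      exact _root_.mem_subfieldUnits.mpr ⟨mul_ne_zero hu1.1 hl'.1, by rw [mul_pow, hu1.2, hl'.2]⟩
    · intro l hl
      exact _root_.div_mem_subfieldUnits hl hu0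
    · intro l _
      rw [mul_div_cancel_left₀ _ hu1.1]
    · intro l _
      rw [mul_div_cancel₀ _ hu1.1]
    · intro l _
      rw [map_mul]
  have h' : (ρ ((u : K) ^ (q + 1)) - 1) * ∑ l ∈ subfieldUnits K q, ρ l = 0 := by
    rw [sub_mul, h, one_mul, sub_self]
  exact (mul_eq_zero.mp h').resolve_left (sub_ne_zero.mpr hu)

/-- The summand depends only on the sphere around `β` on which `w` lies, and all spheres but the
tangential one have the same number of points. -/
theorem sum_mulChar_norm (hψ : IsUnitalFunction q c ψ) (hcard : Fintype.card K = q ^ 2)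
    (hθ : IsTangentFunction q ψ θ) {ρ : MulChar K R} (hρ : ∑ l ∈ subfieldUnits K q, ρ l = 0)
    (β : K) : ∑ w, ρ ((w - β) ^ (q + 1)) * ρ⁻¹ (ψ w) = -(q : R) * ρ (θ β) := by
  have h1 : ∑ w, ρ ((w - β) ^ (q + 1)) * ρ⁻¹ (ψ w) =
      ∑ w ∈ univ.filter fun w => ψ w ≠ 0 ∧ w ≠ β, ρ ((w - β) ^ (q + 1) / ψ w) := by
    rw [sum_filter]
    refine sum_congr rfl fun w _ => ?_
    by_cases h : ψ w ≠ 0 ∧ w ≠ β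
    · rw [if_pos h, div_eq_mul_inv, map_mul, MulChar.inv_apply']
    · rw [if_neg h]
      rw [not_and_or, not_not, not_not] at h
      rcases h with h | h
      · rw [h, MulChar.map_zero, mul_zero]
      · rw [h, sub_self, zero_pow (by omega), MulChar.map_zero, zero_mul]
  rw [h1, ← sum_fiberwise_of_maps_to' (g := fun w => (w - β) ^ (q + 1) / ψ w)
    (t := subfieldUnits K q) (fun w hw => hψ.div_mem_subfieldUnits hcard (mem_filter.mp hw).2.1
      (mem_filter.mp hw).2.2) (fun x => ρ x)]
  have h2 : ∀ l ∈ subfieldUnits K q, (∑ w ∈ (univ.filter fun w => ψ w ≠ 0 ∧ w ≠ β).filter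
      (fun w => (w - β) ^ (q + 1) / ψ w = l), ρ l) = ((sphere q ψ β l).card : R) * ρ l := by
    intro l hl
    rw [filter_div_eq_sphere (_root_.mem_subfieldUnits.mp hl).1, sum_const, nsmul_eq_mul]
  rw [sum_congr rfl h2]
  by_cases hβ : ψ β = 0
  · rw [hθ.eq_zero β hβ, MulChar.map_zero, mul_zero]
    rw [sum_congr rfl fun l hl => by rw [hψ.card_sphere_of_eq_zero hcard hβ hl], ← mul_sum, hρ,
      mul_zero]
  · have h3 : ∀ l ∈ subfieldUnits K q, ((sphere q ψ β l).card : R) * ρ l =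
        ((q + 1 : ℕ) : R) * ρ l - if l = θ β then (q : R) * ρ l else 0 := by
      intro l hl
      split_ifs with h
      · rw [h, hθ.card_sphere β hβ]; push_cast; ring
      · rw [hθ.card_sphere_of_ne β hβ l hl h, sub_zero]
    rw [sum_congr rfl h3, sum_sub_distrib, ← mul_sum, hρ, sum_ite_eq' (subfieldUnits K q) (θ β),
      if_pos (hθ.mem β hβ)]
    ring

lemma sum_mulChar_apply (hψ : IsUnitalFunction q c ψ) {ρ : MulChar K R}
    (hρ : ∑ l ∈ subfieldUnits K q, ρ l = 0) : ∑ w, ρ (ψ w) = 0 := by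
  have h0 : ∑ w, ρ (ψ w) = ∑ w ∈ univ.filter fun w => ψ w ≠ 0, ρ (ψ w) := by
    rw [sum_filter]
    refine sum_congr rfl fun w _ => ?_
    by_cases h : ψ w = 0
    · simp [h, MulChar.map_zero]
    · rw [if_pos h]
  rw [h0, ← sum_fiberwise_of_maps_to' (g := ψ) (t := subfieldUnits K q)
    (fun w hw => hψ.mem_subfieldUnits (mem_filter.mp hw).2) (fun x => ρ x)]
  have h1 : ∀ l ∈ subfieldUnits K q, (∑ w ∈ (univ.filter fun w => ψ w ≠ 0).filter
      (fun w => ψ w = l), ρ l) = q * ρ l := by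
    intro l hl
    have hl' := _root_.mem_subfieldUnits.mp hl
    have h := hψ.card_fiber l hl'.1 hl'.2
    rw [ncard_eq_card_filter] at h
    rw [sum_const, filter_filter, nsmul_eq_mul]
    congr 2
    refine Eq.trans (congrArg card ?_) h
    ext w
    simp only [mem_filter, mem_univ, true_and, and_iff_right_iff_imp]
    rintro rfl
    exact hl'.1
  rw [sum_congr rfl h1, ← mul_sum, hρ, mul_zero]

lemma sum_mulChar_inv_mul_mulChar_add [IsDomain R] {ε : MulChar K R} (hε : ε ≠ 1) {s : K}
    (hs : s ≠ 0) : ∑ x, ε⁻¹ x * ε (s + x) = -1 := by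
  rw [← Equiv.sum_comp (Equiv.inv K)]
  have h1 : ∀ x : K, ε⁻¹ (Equiv.inv K x) * ε (s + Equiv.inv K x) =
      ε (1 + s * x) - if x = 0 then 1 else 0 := by
    intro x
    rw [Equiv.inv_apply, MulChar.inv_apply', inv_inv]
    split_ifs with h
    · simp [h, MulChar.map_zero]
    · rw [← map_mul, mul_add, mul_inv_cancel₀ h, sub_zero, add_comm, mul_comm]
  have h2 : ∑ x, ε (1 + s * x) = ∑ x, ε x :=
    Equiv.sum_comp ((Equiv.mulLeft₀ s hs).trans (Equiv.addLeft 1)) (fun x => ε x)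
  rw [sum_congr rfl fun x _ => h1 x, sum_sub_distrib, h2, MulChar.sum_eq_zero_of_ne_one hε]
  simp

lemma normSumsDvd (hψ : IsUnitalFunction q c ψ) (hcard : Fintype.card K = q ^ 2)
    (hθ : IsTangentFunction q ψ θ) [IsDomain R] {χ : MulChar K R} (hχ : χ ^ (q + 1) ≠ 1) :
    NormSumsDvd q χ ψ := by
  intro β
  have h1 : χ⁻¹ ^ (q + 1) ≠ 1 := by rwa [inv_pow, inv_ne_one]
  have h := hψ.sum_mulChar_norm hcard hθ (sum_subfieldUnits_mulChar hcard h1) β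
  rw [inv_inv] at h
  rw [h]
  exact Dvd.intro _ (neg_mul_comm _ _).symm

/-- The tangent function has the same divisibility property: the character sums of `θ` are obtained
from those of `ψ` by inverting the kernel `χ ((w - β) ^ (q + 1))`. -/
lemma normSumsDvd_tangent (hψ : IsUnitalFunction q c ψ) (hcard : Fintype.card K = q ^ 2)
    (hθ : IsTangentFunction q ψ θ) [IsDomain R] (hq : (q : R) ≠ 0) {χ : MulChar K R}
    (hχ : χ ^ (q + 1) ≠ 1) : NormSumsDvd q χ θ := by
  intro w₀
  have hχ' : χ⁻¹ ^ (q + 1) ≠ 1 := by rwa [inv_pow, inv_ne_one]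
  have h1 := hψ.sum_mulChar_norm hcard hθ (sum_subfieldUnits_mulChar hcard hχ)
  have h2 := hψ.sum_mulChar_apply (sum_subfieldUnits_mulChar hcard hχ')
  have hN : ∀ w, ∑ β, χ⁻¹ ((β - w₀) ^ (q + 1)) * χ ((w - β) ^ (q + 1)) =
      (if w = w₀ then (q : R) ^ 2 else 0) - 1 := by
    intro w
    have h3 : ∑ β, χ⁻¹ ((β - w₀) ^ (q + 1)) * χ ((w - β) ^ (q + 1)) =
        ∑ x, (χ ^ (q + 1))⁻¹ x * (χ ^ (q + 1)) ((w₀ - w) + x) := by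
      rw [← Equiv.sum_comp (Equiv.addRight w₀)]
      refine sum_congr rfl fun x _ => ?_
      rw [Equiv.coe_addRight, add_sub_cancel_right, ← inv_pow, MulChar.pow_apply' _ (by omega),
        MulChar.pow_apply' _ (by omega), map_pow, ← map_pow χ,
        show w - (x + w₀) = -(w₀ - w + x) by ring, neg_pow, neg_one_pow_q_add_one hcard, one_mul]
    rw [h3]
    split_ifs with h
    · have h4 : ∀ x : K, (χ ^ (q + 1))⁻¹ x * (χ ^ (q + 1)) ((w₀ - w) + x) =
          1 - if x = 0 then 1 else 0 := by
        intro x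
        rw [h, sub_self, zero_add]
        split_ifs with hx
        · simp [hx, MulChar.map_zero]
        · rw [← MulChar.mul_apply, inv_mul_cancel, MulChar.one_apply (isUnit_iff_ne_zero.mpr hx),
            sub_zero]
      rw [sum_congr rfl fun x _ => h4 x, sum_sub_distrib]
      simp [hcard]
    · rw [sum_mulChar_inv_mul_mulChar_add hχ (sub_ne_zero.mpr (Ne.symm h)), zero_sub]
  have h5 : (q : R) * -∑ w, χ⁻¹ ((w - w₀) ^ (q + 1)) * χ (θ w) = q * (q * χ⁻¹ (ψ w₀)) := by
    calc _ = ∑ β, χ⁻¹ ((β - w₀) ^ (q + 1)) * (-(q : R) * χ (θ β)) := by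
          rw [mul_neg, ← neg_mul, mul_sum]
          exact sum_congr rfl fun β _ => by ring
      _ = ∑ w, χ⁻¹ (ψ w) * ∑ β, χ⁻¹ ((β - w₀) ^ (q + 1)) * χ ((w - β) ^ (q + 1)) := by
          simp_rw [← h1, mul_sum]
          rw [sum_comm]
          exact sum_congr rfl fun _ _ => sum_congr rfl fun _ _ => by ring
      _ = q * (q * χ⁻¹ (ψ w₀)) := by
          simp_rw [hN, mul_sub, mul_one, sum_sub_distrib]
          rw [h2]
          simp only [mul_ite, mul_zero, sum_ite_eq', mem_univ, if_true]
          ring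
  have h6 := mul_left_cancel₀ hq h5
  rw [← dvd_neg, h6]
  exact dvd_mul_right _ _

end Characters

end IsUnitalFunction

section WittVectors

variable {K : Type*} [Field K] {p : ℕ} [Fact p.Prime]

variable (K p) in
/-- The Teichmüller character of a field, with values in the Witt vectors. -/
noncomputable def teichmullerChar : MulChar K (WittVector p K) where
  toMonoidHom := WittVector.teichmuller p
  map_nonunit' a ha := by
    have : a = 0 := by simpa using ha
    rw [this]
    exact WittVector.teichmuller_zero p

lemma isTeichmuller_teichmullerChar [CharP K p] [PerfectRing K p] :
    IsTeichmuller p (teichmullerChar K p) (WittVector.constantCoeff (R := K) (p := p)) where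
  red_apply x := WittVector.teichmuller_coeff_zero p x
  dvd_of_red_eq_zero a ha := by
    have h := WittVector.ker_constantCoeff (p := p) (k := K)
    have h2 : a ∈ RingHom.ker (WittVector.constantCoeff (R := K) (p := p)) := ha
    rw [h] at h2
    exact Ideal.mem_span_singleton.mp h2

end WittVectors

/-! ### The polynomial of a unital function -/

section PowerCoeff

open Finset Classical

variable {K : Type*} [Field K] [Fintype K] {q : ℕ}

/-- The coefficient of `w ^ e`, `1 ≤ e ≤ card K - 1`, in the polynomial of degree less than `card K`
representing a function `f` with `f 0 = 0`. -/
noncomputable def powerCoeff (f : K → K) (e : ℕ) : K := -∑ w, (w⁻¹) ^ e * f w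

lemma sum_eq_sum_units (g : K → K) (hg : g 0 = 0) : ∑ w, g w = ∑ u : Kˣ, g u := by
  rw [← add_sum_erase univ g (mem_univ 0), hg, zero_add]
  exact sum_bij' (fun w hw => Units.mk0 w (ne_of_mem_erase hw)) (fun u _ => (u : K)) (by simp)
    (by simp) (by simp) (by simp) (by simp)

lemma sum_pow_succ_eq {x : K} (hx : x ≠ 0) :
    ∑ i ∈ range (Fintype.card K - 1), x ^ (i + 1) = if x = 1 then -1 else 0 := by
  have h1 : x ^ (Fintype.card K - 1) = 1 := FiniteField.pow_card_sub_one_eq_one x hx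
  simp_rw [pow_succ', ← mul_sum]
  split_ifs with h
  · simp [h, Nat.cast_sub Fintype.card_pos]
  · have h2 := mul_geom_sum x (Fintype.card K - 1)
    rw [h1, sub_self] at h2
    rw [(mul_eq_zero.mp h2).resolve_left (sub_ne_zero.mpr h), mul_zero]

lemma eq_sum_powerCoeff {f : K → K} (hf : f 0 = 0) (w : K) :
    f w = ∑ i ∈ range (Fintype.card K - 1), powerCoeff f (i + 1) * w ^ (i + 1) := by
  rcases eq_or_ne w 0 with rfl | hw
  · simp [hf]
  have h1 : ∑ i ∈ range (Fintype.card K - 1), powerCoeff f (i + 1) * w ^ (i + 1) =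
      -∑ v, f v * ∑ i ∈ range (Fintype.card K - 1), (v⁻¹ * w) ^ (i + 1) := by
    simp_rw [powerCoeff, neg_mul, sum_neg_distrib, sum_mul, mul_sum]
    rw [sum_comm]
    congr 1
    refine sum_congr rfl fun _ _ => sum_congr rfl fun _ _ => ?_
    rw [mul_pow]; ring
  rw [h1, sum_eq_single w]
  · rw [inv_mul_cancel₀ hw, sum_pow_succ_eq one_ne_zero, if_pos rfl]; ring
  · intro v _ hv
    rcases eq_or_ne v 0 with rfl | hv0
    · rw [hf, zero_mul]
    · rw [sum_pow_succ_eq (mul_ne_zero (inv_ne_zero hv0) hw), if_neg, mul_zero]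
      rw [inv_mul_eq_one₀ hv0]
      exact hv
  · simp

/-- The condition, in terms of the digits of exponents in base `q`, which the divisibility of
character sums imposes on the polynomial of a function. -/
def DigitSupport (p q : ℕ) (f : K → K) : Prop :=
  ∀ s t, s < q → t < q → powerCoeff f (s + q * t) ≠ 0 → s = 0 ∨ t = 0 ∨ (p ∣ s ∧ p ∣ t)

lemma powerCoeff_swap (hcard : Fintype.card K = q ^ 2) {f : K → K} (hf : ∀ w, f w ^ q = f w)
    (s t : ℕ) : powerCoeff f (s + q * t) ^ q = powerCoeff f (t + q * s) := by
  obtain ⟨p, h, hp, _, -, rfl⟩ := exists_prime_pow_eq hcard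
  have := Fact.mk hp
  rw [powerCoeff, powerCoeff, neg_pow, neg_one_pow_q hcard, neg_one_mul, sum_pow_char_pow]
  congr 1
  refine sum_congr rfl fun w _ => ?_
  have h1 : ((w⁻¹) ^ (p ^ h)) ^ (p ^ h) = w⁻¹ := pow_q_pow_q hcard _
  rw [mul_pow, hf, pow_add, pow_add, mul_pow, pow_mul, pow_mul, ← pow_mul _ t, mul_comm t, pow_mul,
    h1, ← pow_mul, mul_comm s, pow_mul]
  ring

lemma NormSumsDvd.digitSupport {R : Type*} [CommRing R] [IsDomain R] {p h : ℕ} [Fact p.Prime]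
    [CharP K p] (hq : q = p ^ h) (hcard : Fintype.card K = q ^ 2) (hq2 : 2 < q) {χ : MulChar K R}
    {red : R →+* K} (hχ : IsTeichmuller p χ red) (hp0 : (p : R) ≠ 0) {f : K → K} (hf0 : f 0 = 0)
    (hfq : ∀ w, f w ^ q = f w) (hf : NormSumsDvd q χ f) : DigitSupport p q f := by
  intro s t hs ht hst
  by_contra! hcon
  obtain ⟨h1, h2, h3⟩ := hcon
  by_cases hps : p ∣ s
  · refine pow_ne_zero q hst ?_
    rw [powerCoeff_swap hcard hfq, powerCoeff,
      hf.coeff_eq_zero hq hcard hq2 hχ hp0 hf0 (h3 hps) ht (Nat.pos_of_ne_zero h1) hs, neg_zero]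
  · refine hst ?_
    rw [powerCoeff,
      hf.coeff_eq_zero hq hcard hq2 hχ hp0 hf0 hps hs (Nat.pos_of_ne_zero h2) ht, neg_zero]

/-- The only exponents allowed by the digit conditions whose sum is congruent to `2` modulo
`q ^ 2 - 1` are `1` and `1`. -/
lemma eq_zero_of_dvd_add {p l i j : ℕ} (hp : 1 < p) (hq : q = p * l) (hq2 : 2 < q)
    (hi : i < q ^ 2 - 1) (hj : j < q ^ 2 - 1) (hij : q ^ 2 - 1 ∣ i + j)
    (h1 : (i + 1) % q = 0 ∨ (i + 1) / q = 0 ∨ (p ∣ (i + 1) % q ∧ p ∣ (i + 1) / q))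
    (h2 : (j + 1) % q = 0 ∨ (j + 1) / q = 0 ∨ (p ∣ (j + 1) % q ∧ p ∣ (j + 1) / q)) :
    i = 0 ∧ j = 0 := by
  have hsq : q * (q - 1) + (q - 1) = q ^ 2 - 1 := by
    obtain ⟨r, rfl⟩ : ∃ r, q = r + 1 := ⟨q - 1, by omega⟩
    rw [Nat.add_sub_cancel]
    refine (Nat.sub_eq_of_eq_add ?_).symm
    ring
  have hpq : p ∣ q := Dvd.intro _ hq.symm
  have e1 := Nat.mod_add_div (i + 1) q
  have e2 := Nat.mod_add_div (j + 1) q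
  have l1 := Nat.mod_lt (i + 1) (show 0 < q by omega)
  have l2 := Nat.mod_lt (j + 1) (show 0 < q by omega)
  set s := (i + 1) % q
  set t := (i + 1) / q
  set s' := (j + 1) % q
  set t' := (j + 1) / q
  have ht : t < q := by
    by_contra! h
    have := Nat.mul_le_mul_left q h
    have : q * q = q * (q - 1) + q := by
      obtain ⟨r, rfl⟩ : ∃ r, q = r + 1 := ⟨q - 1, by omega⟩
      simp; ring
    omega
  have ht' : t' < q := by
    by_contra! h
    have := Nat.mul_le_mul_left q h
    have : q * q = q * (q - 1) + q := by
      obtain ⟨r, rfl⟩ : ∃ r, q = r + 1 := ⟨q - 1, by omega⟩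
      simp; ring
    omega
  have hp1 : ∀ {n : ℕ}, p ∣ n → n ≠ 1 := by
    rintro n hn rfl
    exact absurd (Nat.dvd_one.mp hn) (by omega)
  have hp2 : ¬ p ∣ q - 1 := by
    intro h
    have := Nat.dvd_sub hpq h
    rw [show q - (q - 1) = 1 by omega] at this
    exact hp1 this rfl
  have hp3 : ¬ p ∣ q + 1 := by
    intro h
    have := (Nat.dvd_add_right hpq).mp h
    exact hp1 this rfl
  obtain ⟨m, hm⟩ := hij
  have hm2 : m < 2 := by
    by_contra! h
    have := Nat.mul_le_mul_left (q ^ 2 - 1) h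
    omega
  interval_cases m
  · omega
  exfalso
  -- the digits satisfy `(s + s') + q * (t + t') = 1 + q * q`
  have e3 : (s + s') + q * (t + t') = 1 + q * q := by
    have : q * q = q ^ 2 := by ring
    have : 1 < q ^ 2 := Nat.one_lt_pow two_ne_zero (by omega)
    rw [mul_add]
    omega
  have hcases : (s + s' = 1 ∧ t + t' = q) ∨ (s + s' = q + 1 ∧ t + t' = q - 1) := by
    have hT : t + t' ≤ q := by
      by_contra! h
      have := Nat.mul_le_mul_left q h
      rw [Nat.mul_succ] at this
      omega
    rcases Nat.lt_or_ge (t + t') (q - 1) with h | h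
    · have := Nat.mul_le_mul_left q (show t + t' + 2 ≤ q by omega)
      rw [mul_add] at this
      omega
    · rcases Nat.lt_or_ge (t + t') q with h' | h'
      · right
        have h3 : t + t' = q - 1 := by omega
        rw [h3] at e3
        have : q * q = q * (q - 1) + q := by
          obtain ⟨r, rfl⟩ : ∃ r, q = r + 1 := ⟨q - 1, by omega⟩
          simp; ring
        omega
      · left
        have h3 : t + t' = q := by omega
        rw [h3] at e3
        omega
  rcases hcases with ⟨h3, h4⟩ | ⟨h3, h4⟩
  · rcases Nat.eq_zero_or_pos s with h5 | h5
    · have h6 : s' = 1 := by omega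
      rcases h2 with h | h | h
      · omega
      · omega
      · exact hp1 h.1 h6
    · have h6 : s = 1 := by omega
      rcases h1 with h | h | h
      · omega
      · omega
      · exact hp1 h.1 h6
  · by_cases hps : p ∣ s
    · have hps' : ¬ p ∣ s' := fun h => hp3 (h3 ▸ dvd_add hps h)
      have h5 : s' ≠ 0 := by rintro h; rw [h] at hps'; exact hps' (dvd_zero p)
      have h6 : t' = 0 := by
        rcases h2 with h | h | h
        · exact absurd h h5
        · exact h
        · exact absurd h.1 hps'
      rcases h1 with h | h | h
      · omega
      · omega
      · rw [show t = q - 1 by omega] at h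
        exact hp2 h.2
    · have h5 : s ≠ 0 := by rintro h; rw [h] at hps; exact hps (dvd_zero p)
      have h6 : t = 0 := by
        rcases h1 with h | h | h
        · exact absurd h h5
        · exact h
        · exact absurd h.1 hps
      rcases h2 with h | h | h
      · omega
      · omega
      · rw [show t' = q - 1 by omega] at h
        exact hp2 h.2

lemma digit_lt (hq : 1 < q) {i : ℕ} (hi : i < q ^ 2 - 1) : (i + 1) / q < q := by
  rw [Nat.div_lt_iff_lt_mul (by omega), ← pow_two]
  omega

lemma DigitSupport.of_ne_zero {p : ℕ} {f : K → K} (hf : DigitSupport p q f) (hq : 1 < q) {i : ℕ}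
    (hi : i < q ^ 2 - 1) (h : powerCoeff f (i + 1) ≠ 0) :
    (i + 1) % q = 0 ∨ (i + 1) / q = 0 ∨ (p ∣ (i + 1) % q ∧ p ∣ (i + 1) / q) := by
  refine hf _ _ (Nat.mod_lt _ (by omega)) (digit_lt hq hi) ?_
  rwa [Nat.mod_add_div]

/-- The coefficient of `w ^ 2` in a product is determined by the linear coefficients of the
factors. -/
lemma powerCoeff_one_ne_zero {p l : ℕ} {f g : K → K} (hp : 1 < p) (hq : q = p * l) (hq2 : 2 < q)
    (hcard : Fintype.card K = q ^ 2) (hf0 : f 0 = 0) (hg0 : g 0 = 0) (hf : DigitSupport p q f)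
    (hg : DigitSupport p q g) (h : powerCoeff (fun w => f w * g w) 2 ≠ 0) :
    powerCoeff f 1 ≠ 0 ∧ powerCoeff g 1 ≠ 0 := by
  have hpow : ∀ i j : ℕ, ∑ w : K, (w⁻¹) ^ 2 * (w ^ (i + 1) * w ^ (j + 1)) =
      if q ^ 2 - 1 ∣ i + j then -1 else 0 := by
    intro i j
    rw [sum_eq_sum_units _ (by simp), ← hcard, ← FiniteField.sum_pow_units K (i + j)]
    refine sum_congr rfl fun u _ => ?_
    have := u.ne_zero
    field_simp
    ring
  have hexp : powerCoeff (fun w => f w * g w) 2 =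
      ∑ i ∈ range (q ^ 2 - 1), ∑ j ∈ range (q ^ 2 - 1),
        powerCoeff f (i + 1) * powerCoeff g (j + 1) *
          -(if q ^ 2 - 1 ∣ i + j then -1 else 0 : K) := by
    simp_rw [← hpow]
    rw [powerCoeff]
    have h1 : ∀ w, (w⁻¹) ^ 2 * (f w * g w) =
        ∑ i ∈ range (q ^ 2 - 1), ∑ j ∈ range (q ^ 2 - 1), powerCoeff f (i + 1) *
          powerCoeff g (j + 1) * ((w⁻¹) ^ 2 * (w ^ (i + 1) * w ^ (j + 1))) := by
      intro w
      rw [eq_sum_powerCoeff hf0 w, eq_sum_powerCoeff hg0 w, hcard, sum_mul_sum, mul_sum]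
      refine sum_congr rfl fun _ _ => ?_
      rw [mul_sum]
      exact sum_congr rfl fun _ _ => by ring
    rw [sum_congr rfl fun w _ => h1 w, sum_comm, ← sum_neg_distrib]
    refine sum_congr rfl fun _ _ => ?_
    rw [sum_comm, ← sum_neg_distrib]
    refine sum_congr rfl fun _ _ => ?_
    rw [← mul_sum, mul_neg]
  rw [hexp] at h
  obtain ⟨i, hi, h⟩ := exists_ne_zero_of_sum_ne_zero h
  obtain ⟨j, hj, h⟩ := exists_ne_zero_of_sum_ne_zero h
  rw [mem_range] at hi hj
  have hij : q ^ 2 - 1 ∣ i + j := by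
    by_contra hcon
    rw [if_neg hcon] at h
    simp at h
  have h1 := left_ne_zero_of_mul (left_ne_zero_of_mul h)
  have h2 := right_ne_zero_of_mul (left_ne_zero_of_mul h)
  obtain ⟨rfl, rfl⟩ := eq_zero_of_dvd_add hp hq hq2 hi hj hij (hf.of_ne_zero (by omega) hi h1)
    (hg.of_ne_zero (by omega) hj h2)
  exact ⟨h1, h2⟩

lemma powerCoeff_of_homogeneous {f : K → K} {l m : K} (hl : l ≠ 0) (h : ∀ w, f (l * w) = m * f w)
    (e : ℕ) : l ^ e * powerCoeff f e = m * powerCoeff f e := by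
  have h1 : powerCoeff f e = (l⁻¹) ^ e * (m * powerCoeff f e) := by
    conv_lhs => rw [powerCoeff, ← Equiv.sum_comp (Equiv.mulLeft₀ l hl)]
    simp_rw [Equiv.mulLeft₀_apply, h, mul_inv, mul_pow, powerCoeff, mul_neg, mul_sum]
    congr 1
    exact sum_congr rfl fun w _ => by ring
  conv_lhs => rw [h1]
  rw [← mul_assoc, ← mul_pow, mul_inv_cancel₀ hl, one_pow, one_mul]

lemma sub_one_dvd_of_forall_pow_eq (hcard : Fintype.card K = q ^ 2) {i : ℕ}
    (h : ∀ l ∈ subfieldUnits K q, l ^ (i + 1) = l) : q - 1 ∣ i := by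
  obtain ⟨g, hg⟩ := IsCyclic.exists_generator (α := Kˣ)
  have h1 : orderOf g = (q + 1) * (q - 1) := by
    rw [orderOf_eq_card_of_forall_mem_zpowers hg, card_sq_sub_one hcard]
  have h2 := h _ (norm_mem_subfieldUnits hcard g.ne_zero)
  have h3 : g ^ ((q + 1) * i) = 1 := by
    ext
    have hg0 := pow_ne_zero (q + 1) g.ne_zero
    rw [pow_succ] at h2
    rw [Units.val_pow_eq_pow_val, pow_mul, Units.val_one]
    exact mul_right_cancel₀ hg0 (h2.trans (one_mul _).symm)
  have h4 := orderOf_dvd_of_pow_eq_one h3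
  rw [h1] at h4
  exact Nat.dvd_of_mul_dvd_mul_left (by omega) h4

/-- Exponents surviving both the digit conditions and homogeneity, after raising to the power
`l = q / p`. -/
lemma exists_pow_eq {p l i : ℕ} (hcard : Fintype.card K = q ^ 2) (hp : 1 < p) (hq : q = p * l)
    (hi : i < q ^ 2 - 1)
    (h1 : (i + 1) % q = 0 ∨ (i + 1) / q = 0 ∨ (p ∣ (i + 1) % q ∧ p ∣ (i + 1) / q))
    (h2 : q - 1 ∣ i) : ∃ k ≤ l, ∀ w : K, (w ^ (i + 1)) ^ l = w ^ l * (w ^ (q - 1)) ^ k := by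
  have hq1 := one_lt_of_card_eq_sq hcard
  have hl0 : 0 < l := Nat.pos_of_ne_zero (by rintro rfl; omega)
  have e1 := Nat.mod_add_div (i + 1) q
  have l1 := Nat.mod_lt (i + 1) (show 0 < q by omega)
  have l2 := digit_lt hq1 hi
  set s := (i + 1) % q
  set t := (i + 1) / q
  have hst : s + t = 1 ∨ s + t = q := by
    have h3 : i + 1 = (q - 1) * t + (s + t) := by
      rw [← e1]
      obtain ⟨r, rfl⟩ : ∃ r, q = r + 1 := ⟨q - 1, by omega⟩
      rw [Nat.add_sub_cancel]
      ring
    have h5 : 1 ≤ s + t := by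
      refine Nat.pos_of_ne_zero fun h => ?_
      obtain ⟨h6, h7⟩ := Nat.add_eq_zero_iff.mp h
      rw [h6, h7, mul_zero] at h3
      omega
    have h4 : q - 1 ∣ s + t - 1 := by
      have : i = (q - 1) * t + (s + t - 1) := by omega
      rw [this] at h2
      exact (Nat.dvd_add_right (Dvd.intro _ rfl)).mp h2
    obtain ⟨m, hm⟩ := h4
    have : m < 2 := by
      by_contra! h
      have := Nat.mul_le_mul_left (q - 1) h
      omega
    interval_cases m <;> omega
  have key : ∀ k, k ≤ l → s * l + t * l * q = l + (q - 1) * k + (q ^ 2 - 1) * (t / p) →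
      ∃ k ≤ l, ∀ w : K, (w ^ (i + 1)) ^ l = w ^ l * (w ^ (q - 1)) ^ k := by
    intro k hk h
    refine ⟨k, hk, fun w => ?_⟩
    rcases eq_or_ne w 0 with rfl | hw
    · rw [zero_pow (by omega), zero_pow (by omega), zero_mul]
    · rw [← pow_mul, ← e1, show (s + q * t) * l = s * l + t * l * q by ring, h, pow_add, pow_add,
        pow_mul w (q ^ 2 - 1), ← hcard, FiniteField.pow_card_sub_one_eq_one w hw, one_pow, mul_one,
        pow_mul w (q - 1)]
  obtain ⟨r, hr⟩ : ∃ r, q = r + 1 := ⟨q - 1, by omega⟩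
  have hr' : q - 1 = r := by omega
  have hsq : q ^ 2 - 1 = r * (q + 1) := by
    refine Nat.sub_eq_of_eq_add ?_
    rw [hr]; ring
  rcases h1 with h | h | ⟨⟨u, hu⟩, ⟨v, hv⟩⟩
  · have ht : t = 1 := by omega
    refine key l le_rfl ?_
    rw [h, ht, Nat.div_eq_of_lt hp, hr', hr]
    ring
  · have hs : s = 1 := by omega
    refine key 0 (by omega) ?_
    rw [h, hs, Nat.zero_div]
    ring
  · have huv : u + v = l := by
      rcases hst with h | h
      · have : p ∣ 1 := h ▸ dvd_add ⟨u, hu⟩ ⟨v, hv⟩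
        exact absurd (Nat.dvd_one.mp this) (by omega)
      · refine Nat.eq_of_mul_eq_mul_left (show 0 < p by omega) ?_
        rw [mul_add, ← hu, ← hv, h, hq]
    refine key u (by omega) ?_
    rw [hu, hv, Nat.mul_div_cancel_left _ (show 0 < p by omega), hr', hsq,
      show p * u * l = (p * l) * u by ring, show p * v * l * q = (p * l) * q * v by ring, ← hq,
      ← huv]
    rw [hr]
    ring

end PowerCoeff

/-! ### Unital functions are trace forms -/

namespace IsUnitalFunction

open Finset Classical

variable {K : Type*} [Field K] [Fintype K] {q : ℕ} {c : K} {ψ θ : K → K}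

open Polynomial in
/-- After raising to the power `l = q / p`, the function is a homogeneous form of degree `l` in
`w` and `w ^ q`. -/
lemma exists_polynomial_of_digitSupport {p l h : ℕ} [Fact p.Prime] [CharP K p] (hl : l = p ^ h)
    (hq : q = p * l) (hcard : Fintype.card K = q ^ 2) {f : K → K} (hf0 : f 0 = 0)
    (hf : DigitSupport p q f) (hfl : ∀ a ∈ subfieldUnits K q, ∀ w, f (a * w) = a * f w) :
    ∃ g : K[X], g.natDegree ≤ l ∧ ∀ w, f w ^ l = w ^ l * g.eval (w ^ (q - 1)) := by
  have hp : 1 < p := (Fact.out : p.Prime).one_lt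
  have key : ∀ i, ∃ k ≤ l, i < q ^ 2 - 1 → ∀ w : K,
      (powerCoeff f (i + 1) * w ^ (i + 1)) ^ l =
        w ^ l * (powerCoeff f (i + 1) ^ l * (w ^ (q - 1)) ^ k) := by
    intro i
    by_cases hi : i < q ^ 2 - 1
    · by_cases h0 : powerCoeff f (i + 1) = 0
      · refine ⟨0, Nat.zero_le _, fun _ w => ?_⟩
        rw [h0, zero_mul, zero_pow (by rw [hl]; exact pow_ne_zero _ (by omega)), zero_mul, mul_zero]
      · obtain ⟨k, hk, hkw⟩ := exists_pow_eq hcard hp hq hi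
          (hf.of_ne_zero (one_lt_of_card_eq_sq hcard) hi h0)
          (sub_one_dvd_of_forall_pow_eq hcard fun a ha => mul_right_cancel₀ h0
            (powerCoeff_of_homogeneous (_root_.mem_subfieldUnits.mp ha).1 (hfl a ha) (i + 1)))
        refine ⟨k, hk, fun _ w => ?_⟩
        rw [mul_pow, hkw]
        ring
    · exact ⟨0, Nat.zero_le _, fun h => absurd h hi⟩
  choose k hk hkw using key
  refine ⟨∑ i ∈ range (q ^ 2 - 1), C (powerCoeff f (i + 1) ^ l) * X ^ (k i), ?_, fun w => ?_⟩
  · refine natDegree_sum_le_of_forall_le _ _ fun i _ => ?_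
    exact (natDegree_C_mul_X_pow_le _ _).trans (hk i)
  · rw [eq_sum_powerCoeff hf0 w, hcard, hl, sum_pow_char_pow, ← hl, eval_finsetSum, mul_sum]
    refine sum_congr rfl fun i hi => ?_
    rw [hkw i (mem_range.mp hi) w]
    simp

/-- By the product formula the coefficient of `w ^ 2` in `ψ * θ` does not vanish. -/
lemma powerCoeff_mul_tangent (hψ : IsUnitalFunction q c ψ) (hcard : Fintype.card K = q ^ 2)
    (hq2 : 2 < q) (hθ : IsTangentFunction q ψ θ) : powerCoeff (fun w => ψ w * θ w) 2 ≠ 0 := by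
  have hc := pow_ne_zero (q - 1) hψ.ne_zero
  intro h
  have h1 : c ^ (q - 1) * powerCoeff (fun w => ψ w * θ w) 2 = (c ^ (q - 1)) ^ 2 := by
    rw [powerCoeff, mul_neg, mul_sum]
    have h2 : ∀ w, c ^ (q - 1) * ((w⁻¹) ^ 2 * (ψ w * θ w)) =
        (w⁻¹) ^ 2 * (w ^ q - c ^ (q - 1) * w) ^ 2 := by
      intro w
      rw [← hψ.mul_tangent hcard hθ]
      ring
    have h3 : ∀ u : Kˣ, ((u : K)⁻¹) ^ 2 * ((u : K) ^ q - c ^ (q - 1) * u) ^ 2 =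
        (u : K) ^ (2 * (q - 1)) - 2 * c ^ (q - 1) * (u : K) ^ (q - 1) +
          (c ^ (q - 1)) ^ 2 * u ^ 0 := by
      intro u
      have := u.ne_zero
      obtain ⟨r, hr⟩ : ∃ r, q = r + 1 := ⟨q - 1, by omega⟩
      rw [show q - 1 = r by omega, hr]
      field_simp
      ring
    have hlt : 2 * (q - 1) < q ^ 2 - 1 := by
      obtain ⟨r, rfl⟩ : ∃ r, q = r + 3 := ⟨q - 3, by omega⟩
      have : (r + 3) ^ 2 = r * r + 6 * r + 9 := by ring
      omega
    rw [sum_congr rfl fun w _ => h2 w, sum_eq_sum_units _ (by simp), sum_congr rfl fun u _ => h3 u,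
      sum_add_distrib, sum_sub_distrib, ← mul_sum, ← mul_sum, FiniteField.sum_pow_units,
      FiniteField.sum_pow_units, FiniteField.sum_pow_units, hcard,
      if_neg (Nat.not_dvd_of_pos_of_lt (by omega) hlt),
      if_neg (Nat.not_dvd_of_pos_of_lt (by omega) (by omega)), if_pos (dvd_zero _)]
    ring
  rw [h, mul_zero] at h1
  exact pow_ne_zero 2 hc h1.symm

lemma map_mul_of_powerCoeff (hψ : IsUnitalFunction q c ψ)
    (h : powerCoeff ψ 1 ≠ 0) {a : K} (ha : a ∈ subfieldUnits K q) (w : K) :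
    ψ (a * w) = a * ψ w := by
  have ha' := _root_.mem_subfieldUnits.mp ha
  obtain ⟨m, hm⟩ := hψ.homogeneous a ha'.1 ha'.2
  have h1 := powerCoeff_of_homogeneous ha'.1 hm 1
  rw [pow_one] at h1
  rw [hm, mul_right_cancel₀ h h1]

lemma tangent_mul (hψ : IsUnitalFunction q c ψ) (hcard : Fintype.card K = q ^ 2)
    (hθ : IsTangentFunction q ψ θ) {a : K} (ha : a ∈ subfieldUnits K q)
    (h : ∀ w, ψ (a * w) = a * ψ w) (w : K) : θ (a * w) = a * θ w := by
  have ha' := _root_.mem_subfieldUnits.mp ha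
  have hc := pow_ne_zero (q - 1) hψ.ne_zero
  by_cases hw : ψ w = 0
  · rw [hθ.eq_zero w hw, hθ.eq_zero _ (by rw [h, hw, mul_zero]), mul_zero]
  · have h1 := hψ.mul_tangent hcard hθ (a * w)
    have h2 := hψ.mul_tangent hcard hθ w
    rw [mul_pow, ha'.2, h] at h1
    refine mul_left_cancel₀ (mul_ne_zero hc (mul_ne_zero ha'.1 hw)) ?_
    linear_combination h1 - a ^ 2 * h2

/-- In the field with four elements the function is determined by its zeros. -/
lemma exists_eq_mul_of_eq_two {c : K} {ψ : K → K} (hψ : IsUnitalFunction 2 c ψ)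
    (hcard : Fintype.card K = 2 ^ 2) : ∃ u, ∀ w, ψ w = u * (w ^ 2 - c ^ (2 - 1) * w) := by
  have hc := hψ.ne_zero
  have h2 : (2 : K) = 0 := by exact_mod_cast cast_q_eq_zero hcard
  have h3 : ∀ x : K, x ≠ 0 → x ^ 3 = 1 := fun x hx => by
    have := FiniteField.pow_card_sub_one_eq_one x hx
    rwa [hcard] at this
  refine ⟨c, fun w => ?_⟩
  by_cases hw : ψ w = 0
  · obtain ⟨f, hf, rfl⟩ := (hψ.eq_zero_iff w).mp hw
    rw [hw]
    linear_combination (-c ^ 3) * hf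
  · have h1 : ψ w = 1 := mul_left_cancel₀ hw (by rw [mul_one, ← pow_two]; exact hψ.pow_q w)
    have hw0 : w ≠ 0 := by
      rintro rfl
      exact hw (hψ.map_zero hcard)
    have hwc : w - c ≠ 0 := fun h => hw ((hψ.eq_zero_iff w).mpr
      ⟨1, one_pow _, by rw [mul_one]; exact sub_eq_zero.mp h⟩)
    have h4 : w ^ 2 + w * c + c ^ 2 = 0 := by
      refine (mul_eq_zero.mp ?_).resolve_left hwc
      linear_combination h3 w hw0 - h3 c hc
    rw [h1]
    linear_combination (-c) * h4 + (c ^ 2 * w) * h2 + h3 c hc * (-1) + c ^ 3 * h2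

/-- A unital function is proportional to the additive polynomial `M w = w ^ q - c ^ (q - 1) * w`
with the same zeros. For `q > 2` its power `ψ ^ (q / p)` is a form of degree `q / p` in `w` and
`w ^ q`, and so is that of the tangent function. Their product is a multiple of
`M ^ (2 * (q / p))`, so that both are multiples of `M ^ (q / p)` by unique factorization. -/
theorem exists_eq_mul (hψ : IsUnitalFunction q c ψ) (hcard : Fintype.card K = q ^ 2) :
    ∃ u, ∀ w, ψ w = u * (w ^ q - c ^ (q - 1) * w) := by
  have hq1 := one_lt_of_card_eq_sq hcard
  rcases Nat.lt_or_ge 2 q with hq2 | hq2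
  swap
  · obtain rfl : q = 2 := by omega
    exact exists_eq_mul_of_eq_two hψ hcard
  obtain ⟨p, h, hp, _, h0, hqp⟩ := exists_prime_pow_eq hcard
  have := Fact.mk hp
  obtain ⟨θ, hθ⟩ := hψ.exists_isTangentFunction hcard
  have hψ0 := hψ.map_zero hcard
  have hθ0 := hθ.eq_zero 0 hψ0
  have hθq : ∀ w, θ w ^ q = θ w := by
    intro w
    by_cases hw : ψ w = 0
    · rw [hθ.eq_zero w hw, zero_pow (by omega)]
    · exact (_root_.mem_subfieldUnits.mp (hθ.mem w hw)).2
  have hχ := isTeichmuller_teichmullerChar (K := K) (p := p)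
  have hp0 : (p : WittVector p K) ≠ 0 := WittVector.p_nonzero p K
  have hq0 : (q : WittVector p K) ≠ 0 := by
    rw [hqp, Nat.cast_pow]
    exact pow_ne_zero _ hp0
  have hχ1 : teichmullerChar K p ^ (q + 1) ≠ 1 := by
    refine hχ.pow_ne_one (by omega) ?_
    obtain ⟨r, rfl⟩ : ∃ r, q = r + 3 := ⟨q - 3, by omega⟩
    have : (r + 3) ^ 2 = r * r + 6 * r + 9 := by ring
    omega
  have hdψ : DigitSupport p q ψ := (hψ.normSumsDvd hcard hθ hχ1).digitSupport hqp hcard hq2 hχ hp0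
    hψ0 hψ.pow_q
  have hdθ : DigitSupport p q θ := (hψ.normSumsDvd_tangent hcard hθ hq0 hχ1).digitSupport hqp hcard
    hq2 hχ hp0 hθ0 hθq
  set l := p ^ (h - 1) with hl
  have hql : q = p * l := by rw [hqp, hl, ← pow_succ', Nat.sub_add_cancel h0]
  have hl0 : l ≠ 0 := pow_ne_zero _ hp.ne_zero
  have h1 := powerCoeff_one_ne_zero hp.one_lt hql hq2 hcard hψ0 hθ0 hdψ hdθ
    (hψ.powerCoeff_mul_tangent hcard hq2 hθ)
  have hψl : ∀ a ∈ subfieldUnits K q, ∀ w, ψ (a * w) = a * ψ w :=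
    fun a ha w => hψ.map_mul_of_powerCoeff h1.1 ha w
  have hθl : ∀ a ∈ subfieldUnits K q, ∀ w, θ (a * w) = a * θ w :=
    fun a ha w => hψ.tangent_mul hcard hθ ha (hψl a ha) w
  obtain ⟨g, hg, hgw⟩ := exists_polynomial_of_digitSupport hl hql hcard hψ0 hdψ hψl
  obtain ⟨g', hg', hgw'⟩ := exists_polynomial_of_digitSupport hl hql hcard hθ0 hdθ hθl
  have hc := pow_ne_zero (q - 1) hψ.ne_zero
  set a := c ^ (q - 1) with ha
  have h2l : 2 * l ≤ q := by
    rw [hql]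
    exact Nat.mul_le_mul_right l hp.two_le
  -- the identity `ψ * θ = const * M ^ 2` becomes an identity of polynomials, as `w ^ (q - 1)`
  -- takes `q + 1` different values
  have hpoly : Polynomial.C (a ^ l) * (g * g') = (Polynomial.X - Polynomial.C a) ^ (2 * l) := by
    have hcardker := IsCyclic.card_powMonoidHom_range (G := Kˣ) (q - 1)
    rw [card_sq_sub_one hcard, Nat.gcd_eq_right (Dvd.intro_left _ rfl),
      Nat.mul_div_cancel _ (by omega)] at hcardker
    let S : Finset K := univ.image
      fun u : (powMonoidHom (q - 1) : Kˣ →* Kˣ).range => ((u : Kˣ) : K)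
    have hS : S.card = q + 1 := by
      rw [card_image_of_injective _ fun _ _ h => Subtype.ext (Units.ext h), card_univ,
        ← Nat.card_eq_fintype_card, hcardker]
    rw [← sub_eq_zero]
    refine Polynomial.eq_zero_of_natDegree_lt_card_of_eval_eq_zero' _ S (fun z hz => ?_) ?_
    · obtain ⟨⟨_, w, rfl⟩, -, rfl⟩ := mem_image.mp hz
      have hw := w.ne_zero
      have e1 := hψ.mul_tangent hcard hθ w
      have e2 : a ^ l * (ψ w ^ l * θ w ^ l) = ((w : K) ^ q - a * w) ^ (2 * l) := by
        rw [pow_mul, ← e1, mul_pow, mul_pow]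
      rw [hgw, hgw'] at e2
      have e3 : (w : K) ^ q - a * w = w * ((w : K) ^ (q - 1) - a) := by
        obtain ⟨r, hr⟩ : ∃ r, q = r + 1 := ⟨q - 1, by omega⟩
        rw [show q - 1 = r by omega, hr]
        ring
      rw [e3, mul_pow, two_mul, pow_add] at e2
      simp only [Polynomial.eval_sub, Polynomial.eval_mul, Polynomial.eval_pow, Polynomial.eval_C,
        Polynomial.eval_X, powMonoidHom_apply, Units.val_pow_eq_pow_val, sub_eq_zero]
      refine mul_left_cancel₀ (mul_ne_zero (pow_ne_zero l hw) (pow_ne_zero l hw)) ?_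
      rw [two_mul]
      linear_combination e2
    · rw [hS]
      refine Nat.lt_succ_of_le ((Polynomial.natDegree_sub_le _ _).trans (max_le ?_ ?_))
      · refine (Polynomial.natDegree_C_mul_le _ _).trans (Polynomial.natDegree_mul_le.trans ?_)
        omega
      · rw [Polynomial.natDegree_pow, Polynomial.natDegree_X_sub_C]
        omega
  obtain ⟨i, -, hi⟩ := (dvd_prime_pow (Polynomial.prime_X_sub_C a) _).mp
    (Dvd.intro_left (Polynomial.C (a ^ l) * g') (by rw [← hpoly]; ring) : g ∣ _)
  obtain ⟨j, -, hj⟩ := (dvd_prime_pow (Polynomial.prime_X_sub_C a) _).mp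
    (Dvd.intro_left (Polynomial.C (a ^ l) * g) (by rw [← hpoly]; ring) : g' ∣ _)
  have hdi : g.natDegree = i := by
    rw [Polynomial.natDegree_eq_of_degree_eq (Polynomial.degree_eq_degree_of_associated hi),
      Polynomial.natDegree_pow, Polynomial.natDegree_X_sub_C, mul_one]
  have hdj : g'.natDegree = j := by
    rw [Polynomial.natDegree_eq_of_degree_eq (Polynomial.degree_eq_degree_of_associated hj),
      Polynomial.natDegree_pow, Polynomial.natDegree_X_sub_C, mul_one]
  have hne : g * g' ≠ 0 := by
    intro h
    rw [h, mul_zero] at hpoly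
    exact pow_ne_zero _ (Polynomial.X_sub_C_ne_zero a) hpoly.symm
  have hdeg : g.natDegree + g'.natDegree = 2 * l := by
    rw [← Polynomial.natDegree_mul (left_ne_zero_of_mul hne) (right_ne_zero_of_mul hne),
      ← Polynomial.natDegree_C_mul (pow_ne_zero l hc), hpoly, Polynomial.natDegree_pow,
      Polynomial.natDegree_X_sub_C, mul_one]
  have hil : i = l := by omega
  rw [hil] at hi
  obtain ⟨v, hv⟩ := hi.symm
  obtain ⟨v₀, hv₀, hv₁⟩ := Polynomial.isUnit_iff.mp v.isUnit
  have hFrob : Function.Bijective fun x : K => x ^ l := by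
    rw [← Finite.injective_iff_bijective]
    intro x y hxy
    exact iterateFrobenius_inj K p (h - 1) (by simpa [iterateFrobenius_def] using hxy)
  obtain ⟨u, hu⟩ := hFrob.2 v₀
  refine ⟨u, fun w => hFrob.1 ?_⟩
  simp only at hu ⊢
  rw [hgw, ← hv, ← hv₁, mul_pow, hu]
  have e3 : (w : K) ^ q - a * w = w * ((w : K) ^ (q - 1) - a) := by
    obtain ⟨r, hr⟩ : ∃ r, q = r + 1 := ⟨q - 1, by omega⟩
    rw [show q - 1 = r by omega, hr]
    ring
  rw [e3, mul_pow]
  simp only [Polynomial.eval_mul, Polynomial.eval_pow, Polynomial.eval_sub, Polynomial.eval_C,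
    Polynomial.eval_X]
  ring

/-- A unital function is the trace of a linear function. -/
theorem exists_eq_trace (hψ : IsUnitalFunction q c ψ) (hcard : Fintype.card K = q ^ 2) :
    ∃ b ≠ 0, ∀ w, ψ w = b * w + b ^ q * w ^ q := by
  have hq1 := one_lt_of_card_eq_sq hcard
  obtain ⟨u, hu⟩ := hψ.exists_eq_mul hcard
  have h1 : ∀ w, (u ^ q + u * c ^ (q - 1)) * w = (u + u ^ q * (c ^ (q - 1)) ^ q) * w ^ q := by
    intro w
    have := hψ.pow_q w
    rw [hu, mul_pow, sub_pow_q hcard, pow_q_pow_q hcard, mul_pow] at this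
    linear_combination this
  have h2 : u + u ^ q * (c ^ (q - 1)) ^ q = 0 := by
    by_contra hne
    have h3 := h1 1
    rw [one_pow] at h3
    have h4 : ∀ w : K, w ^ q = w := by
      intro w
      have h5 := h1 w
      rw [mul_one, mul_one] at h3
      rw [h3] at h5
      exact (mul_left_cancel₀ hne h5).symm
    have h5 := card_subfieldUnits hcard
    have h6 : subfieldUnits K q = univ.erase 0 := by
      ext x; simp [h4]
    rw [h6, card_erase_of_mem (mem_univ 0), card_univ, hcard] at h5
    have : q * 2 ≤ q * q := Nat.mul_le_mul_left q hq1
    have : q ^ 2 = q * q := by ring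
    omega
  have hb : (-(u * c ^ (q - 1))) ^ q = u := by
    rw [neg_pow, neg_one_pow_q hcard, mul_pow]
    linear_combination -h2
  refine ⟨-(u * c ^ (q - 1)), ?_, fun w => ?_⟩
  · intro h
    rw [h, zero_pow (by omega)] at hb
    have h3 := hψ.card_nonzeros hcard
    rw [filter_false_of_mem (by intro w _; simp [hu, ← hb]), card_empty] at h3
    have := Nat.mul_pos (show 0 < q by omega) (show 0 < q - 1 by omega)
    omega
  · rw [hb, hu]
    ring

end IsUnitalFunction

/-! ### Point sets in an affine chart and their diagonal symmetries -/

/-- The properties of the relation `V y w`, saying that the point `(1 : y : w)` lies on a unital,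
when `(1 : 0 : 0)` and `(0 : 0 : 1)` are points of the unital whose tangents meet
in `(0 : 1 : 0)`. -/
structure IsUnitalChart {K : Type*} [Field K] (q : ℕ) (V : K → K → Prop) : Prop where
  apply_zero : ∀ y, V y 0 ↔ y = 0
  card_left : ∀ w, {y | V y w}.ncard = 1 ∨ {y | V y w}.ncard = q + 1
  card_right : ∀ y, {w | V y w}.ncard = q
  card_slope : ∀ γ, γ ≠ 0 → {w | w ≠ 0 ∧ V (γ * w) w}.ncard = q
  card_line : ∀ α γ, α ≠ 0 → γ ≠ 0 →
    {w | V (α + γ * w) w}.ncard = 1 ∨ {w | V (α + γ * w) w}.ncard = q + 1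

/-- The group of pairs `(h, l)` such that `(1 : y : w) ↦ (1 : h * y : l * w)` preserves a point
set. -/
def chartGroup {K : Type*} [Field K] (V : K → K → Prop) : Subgroup (Kˣ × Kˣ) where
  carrier := {g | ∀ y w, V y w ↔ V (g.1 * y) (g.2 * w)}
  mul_mem' := by
    intro a b ha hb y w
    rw [hb, ha]
    simp [mul_assoc]
  one_mem' := by simp
  inv_mem' := by
    intro a ha y w
    rw [ha (_ * y)]
    simp

lemma mem_chartGroup {K : Type*} [Field K] {V : K → K → Prop} {g : Kˣ × Kˣ} :
    g ∈ chartGroup V ↔ ∀ y w, V y w ↔ V (g.1 * y) (g.2 * w) := Iff.rfl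

section UnitsSubgroups

variable {K : Type*} [Field K] [Finite K]

lemma subgroup_card_le_ncard (S : Subgroup Kˣ) (T : Set K) {x : K} (hx : x ≠ 0)
    (h : ∀ u ∈ S, (u : K) * x ∈ T) : Nat.card S ≤ T.ncard := by
  refine Nat.card_le_card_of_injective (β := T) (fun u => ⟨(u : Kˣ) * x, h u u.2⟩) ?_
  intro u v huv
  have := congrArg Subtype.val huv
  exact Subtype.ext (Units.ext (mul_right_cancel₀ hx this))

lemma exists_mul_eq_of_card_eq (S : Subgroup Kˣ) (T : Set K) {x : K} (hx : x ≠ 0)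
    (h : ∀ u ∈ S, (u : K) * x ∈ T) (hcard : T.ncard ≤ Nat.card S) {y : K} (hy : y ∈ T) :
    ∃ u ∈ S, (u : K) * x = y := by
  have hinj : Function.Injective (fun u : S => (⟨(u : Kˣ) * x, h u u.2⟩ : T)) := by
    intro u v huv
    have := congrArg Subtype.val huv
    exact Subtype.ext (Units.ext (mul_right_cancel₀ hx this))
  obtain ⟨u, hu⟩ := (hinj.bijective_of_nat_card_le hcard).2 ⟨y, hy⟩
  exact ⟨u, u.2, congrArg Subtype.val hu⟩

/-- A cyclic group has at most one subgroup of each order. -/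
lemma mem_iff_pow_card_eq_one (S : Subgroup Kˣ) (u : Kˣ) : u ∈ S ↔ u ^ Nat.card S = 1 := by
  have h1 : S ≤ (powMonoidHom (Nat.card S) : Kˣ →* Kˣ).ker := by
    intro v hv
    rw [MonoidHom.mem_ker, powMonoidHom_apply]
    exact congrArg Subtype.val (pow_card_eq_one' (x := (⟨v, hv⟩ : S)))
  have h2 := IsCyclic.card_powMonoidHom_ker (G := Kˣ) (Nat.card S)
  rw [Nat.gcd_eq_right (Subgroup.card_subgroup_dvd_card S)] at h2
  have h3 := Subgroup.eq_of_le_of_card_ge h1 h2.le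
  conv_lhs => rw [h3]
  rw [MonoidHom.mem_ker, powMonoidHom_apply]

end UnitsSubgroups

namespace IsUnitalChart

lemma map_zero_zero {K : Type*} [Field K] {q : ℕ} {V : K → K → Prop} (hV : IsUnitalChart q V) :
    V 0 0 := (hV.apply_zero 0).mpr rfl

variable {K : Type*} [Field K] [Fintype K] {q : ℕ} {V : K → K → Prop}

lemma ncard_zeros {K : Type*} [Field K] [Finite K] {q : ℕ} {V : K → K → Prop}
    (hV : IsUnitalChart q V) : {w | w ≠ 0 ∧ V 0 w}.ncard = q - 1 := by
  have h1 : {w | w ≠ 0 ∧ V 0 w} = {w | V 0 w} \ {0} := by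
    ext w; simp [and_comm]
  rw [h1, Set.ncard_sdiff_singleton_of_mem (by exact hV.map_zero_zero), hV.card_right]

/-- A group of `q ^ 2 - 1` diagonal collineations has exactly `q + 1` elements fixing each
of the points `(1 : 0 : w)`, and these permute regularly the points of the unital with `y ≠ 0` and
a given `w`. -/
theorem exists_isUnitalFunction (hV : IsUnitalChart q V) (hcard : Fintype.card K = q ^ 2)
    (hΓ : Nat.card (chartGroup V) = q ^ 2 - 1) :
    ∃ c ψ, IsUnitalFunction q c ψ ∧ ∀ y w, V y w ↔ y ^ (q + 1) = ψ w := by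
  have hq := one_lt_of_card_eq_sq hcard
  set Γ := chartGroup V with hΓdef
  set H := Γ.comap (MonoidHom.inl Kˣ Kˣ)
  set L := Γ.map (MonoidHom.snd Kˣ Kˣ)
  have hHmem : ∀ h ∈ H, ∀ y w, V y w ↔ V (h * y) w := by
    intro h hh y w
    have := mem_chartGroup.mp (Subgroup.mem_comap.mp hh) y w
    simpa using this
  have hLmem : ∀ l ∈ L, ∃ h : Kˣ, ∀ y w, V y w ↔ V (h * y) (l * w) := by
    rintro _ ⟨⟨h, l⟩, hg, rfl⟩
    exact ⟨h, hg⟩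
  have hmul : Nat.card H * Nat.card L = q ^ 2 - 1 := by
    have h1 := Subgroup.card_mul_index ((MonoidHom.snd Kˣ Kˣ).domRestrict Γ).ker
    rw [Subgroup.index_ker, MonoidHom.domRestrict_range, hΓ] at h1
    rw [← h1]
    congr 1
    refine Nat.card_congr
      { toFun := fun h => ⟨⟨((h : Kˣ), 1), by simpa using Subgroup.mem_comap.mp h.2⟩, rfl⟩
        invFun := fun g => ⟨(g : Γ).1.1, ?_⟩
        left_inv := fun h => rfl
        right_inv := fun g => ?_ }
    · have h2 : (g : Γ).1.2 = 1 := g.2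
      have h3 := (g : Γ).2
      rw [Subgroup.mem_comap, MonoidHom.inl_apply, ← h2]
      exact h3
    · have h2 : (g : Γ).1.2 = 1 := g.2
      exact Subtype.ext (Subtype.ext (Prod.ext rfl h2.symm))
  obtain ⟨d, hd0, hd⟩ : {w | w ≠ 0 ∧ V 0 w}.Nonempty := by
    rw [← Set.ncard_pos, hV.ncard_zeros]
    omega
  have hLd : ∀ l ∈ L, (l : K) * d ∈ {w | w ≠ 0 ∧ V 0 w} := by
    intro l hl
    obtain ⟨h, hh⟩ := hLmem l hl
    exact ⟨mul_ne_zero l.ne_zero hd0, by simpa using (hh 0 d).mp hd⟩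
  have hL := subgroup_card_le_ncard L _ hd0 hLd
  rw [hV.ncard_zeros] at hL
  have hHle : ∀ y w, y ≠ 0 → V y w → Nat.card H ≤ q + 1 := by
    intro y w hy hyw
    have h1 := subgroup_card_le_ncard H {y | V y w} hy fun h hh => (hHmem h hh y w).mp hyw
    rcases hV.card_left w with h | h <;> omega
  obtain ⟨w₁, hw₁⟩ : {w | V 1 w}.Nonempty := by
    rw [← Set.ncard_pos, hV.card_right]
    omega
  have hH := hHle 1 w₁ one_ne_zero hw₁
  obtain ⟨r, rfl⟩ : ∃ r, q = r + 1 := ⟨q - 1, by omega⟩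
  have e1 : (r + 1) ^ 2 - 1 = (r + 2) * r := by
    refine Nat.sub_eq_of_eq_add ?_
    ring
  rw [Nat.add_sub_cancel] at hL
  rw [e1] at hmul
  have hHcard : Nat.card H = r + 1 + 1 := by
    nlinarith
  have hLcard : Nat.card L = r := by
    rw [hHcard] at hmul
    exact Nat.eq_of_mul_eq_mul_left (by omega) hmul
  have hVH : ∀ y y' w, y ≠ 0 → V y w → (V y' w ↔ y' ^ (r + 1 + 1) = y ^ (r + 1 + 1)) := by
    intro y y' w hy hyw
    constructor
    · intro hy'
      obtain ⟨u, hu, rfl⟩ := exists_mul_eq_of_card_eq H {y | V y w} hy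
        (fun h hh => (hHmem h hh y w).mp hyw) (by
          rw [hHcard]
          rcases hV.card_left w with h | h <;> omega) hy'
      rw [mem_iff_pow_card_eq_one, hHcard] at hu
      have hu' := congrArg Units.val hu
      rw [Units.val_pow_eq_pow_val, Units.val_one] at hu'
      rw [mul_pow, hu', one_mul]
    · intro hy'
      have hy0 : y' ≠ 0 := by
        rintro rfl
        rw [zero_pow (by omega)] at hy'
        exact pow_ne_zero _ hy hy'.symm
      have : Units.mk0 y' hy0 / Units.mk0 y hy ∈ H := by
        rw [mem_iff_pow_card_eq_one, hHcard]
        ext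
        simp only [Units.val_pow_eq_pow_val, Units.val_div_eq_div_val, Units.val_mk0, Units.val_one,
          div_pow, hy', div_self (pow_ne_zero _ hy)]
      have h2 := (hHmem _ this y w).mp hyw
      rwa [Units.val_div_eq_div_val, Units.val_mk0, Units.val_mk0, div_mul_cancel₀ _ hy] at h2
  have hex : ∀ w, ∃ y, V y w := by
    intro w
    have : {y | V y w}.Nonempty := by
      rw [← Set.ncard_pos]
      rcases hV.card_left w with h | h <;> omega
    exact this
  have hVψ : ∃ ψ : K → K, ∀ y w, V y w ↔ y ^ (r + 1 + 1) = ψ w := by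
    choose y hy using hex
    refine ⟨fun w => y w ^ (r + 1 + 1), fun y' w => ?_⟩
    by_cases hy' : y' = 0
    · subst hy'
      by_cases h0 : y w = 0
      · have := hy w
        rw [h0] at this
        simp [h0, this]
      · exact hVH (y w) 0 w h0 (hy w)
    · constructor
      · intro h
        exact ((hVH y' (y w) w hy' h).mp (hy w)).symm
      · intro h
        have h0 : y w ≠ 0 := by
          intro h0
          simp only [h0] at h
          rw [zero_pow (by omega)] at h
          exact hy' (pow_eq_zero_iff (by omega) |>.mp h)
        exact (hVH (y w) y' w h0 (hy w)).mpr h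
  obtain ⟨ψ, hψ⟩ := hVψ
  have hL' : ∀ l, l ≠ 0 → l ^ (r + 1) = l → ∃ h : Kˣ, ∀ y w, V y w ↔ V (h * y) (l * w) := by
    intro l hl hlq
    refine hLmem (Units.mk0 l hl) ?_
    rw [mem_iff_pow_card_eq_one, hLcard]
    ext
    simpa using (pow_sub_one_eq_one_iff (q := r + 1) (by omega) hl).mpr hlq
  refine ⟨d, ψ, ⟨hd0, fun w => ?_, fun w => ?_, fun n hn hnq => ?_, fun n hn hnq => ?_,
    fun α γ hα hγ => ?_, fun l hl hlq => ?_⟩, hψ⟩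
  · obtain ⟨y, hy⟩ := hex w
    rw [← (hψ y w).mp hy, norm_pow_q hcard]
  · have h0 : ψ w = 0 ↔ V 0 w := by rw [hψ, zero_pow (by omega), eq_comm]
    rw [h0]
    constructor
    · intro hw
      rcases eq_or_ne w 0 with rfl | hw0
      · exact ⟨0, zero_pow (by omega), by simp⟩
      · obtain ⟨u, hu, rfl⟩ := exists_mul_eq_of_card_eq L {w | w ≠ 0 ∧ V 0 w} hd0 hLd (by
          rw [hV.ncard_zeros, hLcard, Nat.add_sub_cancel]) ⟨hw0, hw⟩
        rw [mem_iff_pow_card_eq_one, hLcard] at hu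
        refine ⟨u, ?_, mul_comm _ _⟩
        rw [← pow_sub_one_eq_one_iff (by omega) u.ne_zero]
        simpa using congrArg Units.val hu
    · rintro ⟨f, hf, rfl⟩
      rcases eq_or_ne f 0 with rfl | hf0
      · rw [mul_zero]
        exact hV.map_zero_zero
      · obtain ⟨h, hh⟩ := hL' f hf0 hf
        have := (hh 0 d).mp hd
        rwa [mul_zero, mul_comm] at this
  · obtain ⟨y, -, rfl⟩ := exists_pow_q_add_one_eq hcard (mem_subfieldUnits.mpr ⟨hn, hnq⟩)
    refine Eq.trans (congrArg Set.ncard ?_) (hV.card_right y)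
    ext w
    rw [Set.mem_ofPred_eq, Set.mem_ofPred_eq, hψ, eq_comm]
  · obtain ⟨y, hy, rfl⟩ := exists_pow_q_add_one_eq hcard (mem_subfieldUnits.mpr ⟨hn, hnq⟩)
    refine Eq.trans (congrArg Set.ncard ?_) (hV.card_slope y hy)
    ext w
    rw [Set.mem_ofPred_eq, Set.mem_ofPred_eq, hψ, eq_comm (a := ψ w), mul_pow]
  · simp only [← hψ]
    exact hV.card_line α γ hα hγ
  · obtain ⟨h, hh⟩ := hL' l hl hlq
    refine ⟨h ^ (r + 1 + 1), fun w => ?_⟩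
    obtain ⟨y, hy⟩ := hex w
    rw [← (hψ y w).mp hy, ← (hψ _ _).mp ((hh y w).mp hy), mul_pow]

end IsUnitalChart

/-! ### Unitals in homogeneous coordinates -/

/-- The point represented by the coordinate vector `v` belongs to `U`. -/
def HasPoint {K : Type*} [Field K] (U : Set (PlanePoint K)) (v : Fin 3 → K) : Prop :=
  ∃ h : v ≠ 0, Projectivization.mk K v h ∈ U

/-- The point with coordinates `(x : y : z)` relative to the projective frame given by the columns
of `A` belongs to `U`. -/
def HasCoords {K : Type*} [Field K] (U : Set (PlanePoint K))
    (A : Matrix.GeneralLinearGroup (Fin 3) K) (x y z : K) : Prop :=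
  HasPoint U (A • ![x, y, z])

section Points

variable {K : Type*} [Field K] {U : Set (PlanePoint K)} {A : Matrix.GeneralLinearGroup (Fin 3) K}

lemma hasPoint_iff {v : Fin 3 → K} (hv : v ≠ 0) :
    HasPoint U v ↔ Projectivization.mk K v hv ∈ U :=
  ⟨fun h => h.2, fun h => ⟨hv, h⟩⟩

lemma hasPoint_smul {a : K} (ha : a ≠ 0) (v : Fin 3 → K) : HasPoint U (a • v) ↔ HasPoint U v := by
  by_cases hv : v = 0
  · simp [HasPoint, hv]
  · rw [hasPoint_iff hv, hasPoint_iff (smul_ne_zero ha hv)]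
    have : Projectivization.mk K (a • v) (smul_ne_zero ha hv) = Projectivization.mk K v hv :=
      (Projectivization.mk_eq_mk_iff' K _ _ _ _).mpr ⟨a, rfl⟩
    rw [this]

lemma gl_smul_smul (a : K) (v : Fin 3 → K) : A • (a • v) = a • (A • v) := by
  rw [Units.smul_def, Units.smul_def, Matrix.smul_eq_mulVec, Matrix.smul_eq_mulVec,
    Matrix.mulVec_smul]

lemma hasCoords_mul {a : K} (ha : a ≠ 0) {x y z : K} :
    HasCoords U A (a * x) (a * y) (a * z) ↔ HasCoords U A x y z := by
  rw [HasCoords, HasCoords, ← hasPoint_smul ha (A • ![x, y, z]), ← gl_smul_smul]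
  simp

open Classical in
lemma ncard_inter_range {X Y : Type*} [Fintype X] (U : Set Y) {F : X → Y}
    (hF : Function.Injective F) :
    (U ∩ Set.range F).ncard = ∑ o, if F o ∈ U then 1 else 0 := by
  rw [← Set.image_preimage_eq_inter_range, Set.ncard_image_of_injective _ hF, Finset.sum_boole,
    Nat.cast_id]
  exact ncard_eq_card_filter fun o => F o ∈ U

open Classical in
lemma ncard_inter_span [Fintype K] {u v : Fin 3 → K} (h : LinearIndependent K ![u, v]) :
    (U ∩ {P | P.submodule ≤ Submodule.span K {u, v}}).ncard =
      {t : K | HasPoint U (u + t • v)}.ncard + if HasPoint U v then 1 else 0 := by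
  have h' := LinearIndependent.pair_iff.mp h
  have hv : v ≠ 0 := by
    rintro rfl
    simpa using h' 0 1 (by simp)
  have hu : ∀ t : K, u + t • v ≠ 0 := by
    intro t ht
    simpa using h' 1 t (by simpa using ht)
  let F : Option K → PlanePoint K := fun o =>
    o.elim (Projectivization.mk K v hv) fun t => Projectivization.mk K (u + t • v) (hu t)
  have hF : Function.Injective F := by
    rintro (_ | s) (_ | t) hst
    · rfl
    · obtain ⟨a, ha⟩ := (Projectivization.mk_eq_mk_iff' K _ _ _ _).mp hst
      obtain ⟨h1, h2⟩ := h' a (a * t - 1) (by rw [← sub_eq_zero.mpr ha]; module)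
      simp [h1] at h2
    · obtain ⟨a, ha⟩ := (Projectivization.mk_eq_mk_iff' K _ _ _ _).mp hst
      obtain ⟨h1, -⟩ := h' 1 (s - a) (by rw [← sub_eq_zero.mpr ha.symm]; module)
      simp at h1
    · obtain ⟨a, ha⟩ := (Projectivization.mk_eq_mk_iff' K _ _ _ _).mp hst
      obtain ⟨h1, h2⟩ := h' (1 - a) (s - a * t) (by rw [← sub_eq_zero.mpr ha.symm]; module)
      have h3 : a = 1 := (sub_eq_zero.mp h1).symm
      rw [h3, one_mul] at h2
      rw [sub_eq_zero.mp h2]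
  have hr : {P : PlanePoint K | P.submodule ≤ Submodule.span K {u, v}} = Set.range F := by
    ext P
    induction P using Projectivization.ind with | _ x hx =>
    rw [Set.mem_ofPred_eq, Projectivization.submodule_mk, Submodule.span_singleton_le_iff_mem,
      Submodule.mem_span_pair]
    constructor
    · rintro ⟨a, b, hab⟩
      by_cases ha : a = 0
      · refine ⟨none, (Projectivization.mk_eq_mk_iff' K _ _ _ _).mpr ⟨b⁻¹, ?_⟩⟩
        have hb : b ≠ 0 := by
          rintro rfl
          exact hx (by rw [← hab, ha]; simp)
        rw [← hab, ha, zero_smul, zero_add, smul_smul, inv_mul_cancel₀ hb, one_smul]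
      · refine ⟨some (b / a), (Projectivization.mk_eq_mk_iff' K _ _ _ _).mpr ⟨a⁻¹, ?_⟩⟩
        rw [← hab, smul_add, smul_smul, smul_smul, inv_mul_cancel₀ ha, one_smul, div_eq_inv_mul]
    · rintro ⟨_ | t, ht⟩
      · obtain ⟨a, ha⟩ := (Projectivization.mk_eq_mk_iff' K _ _ _ _).mp ht.symm
        exact ⟨0, a, by rw [← ha]; simp⟩
      · obtain ⟨a, ha⟩ := (Projectivization.mk_eq_mk_iff' K _ _ _ _).mp ht.symm
        exact ⟨a, a * t, by rw [← ha]; module⟩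
  rw [hr, ncard_inter_range U hF, Fintype.sum_option, add_comm]
  have h1 : (F none ∈ U) = HasPoint U v := propext (hasPoint_iff hv).symm
  have h2 : ∀ t, (F (some t) ∈ U) = HasPoint U (u + t • v) :=
    fun t => propext (hasPoint_iff (hu t)).symm
  simp_rw [h1, h2]
  rw [ncard_eq_card_filter, Finset.sum_boole, Nat.cast_id]

open Classical in
/-- The number of points on the line through two points given by coordinates. -/
lemma IsUnital.ncard_line {q : ℕ} [Fintype K] (hU : IsUnital q U) {x y z x' y' z' : K}
    (h : ∀ s t, s * x + t * x' = 0 → s * y + t * y' = 0 → s * z + t * z' = 0 → s = 0 ∧ t = 0) :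
    {t | HasCoords U A (x + t * x') (y + t * y') (z + t * z')}.ncard +
      (if HasCoords U A x' y' z' then 1 else 0) = 1 ∨
    {t | HasCoords U A (x + t * x') (y + t * y') (z + t * z')}.ncard +
      (if HasCoords U A x' y' z' then 1 else 0) = q + 1 := by
  have hli : LinearIndependent K ![A • ![x, y, z], A • ![x', y', z']] := by
    rw [LinearIndependent.pair_iff]
    intro s t hst
    rw [← gl_smul_smul, ← gl_smul_smul, ← smul_add, smul_eq_zero_iff_eq] at hst
    have h0 := congrFun hst 0
    have h1 := congrFun hst 1
    have h2 := congrFun hst 2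
    simp at h0 h1 h2
    exact h s t h0 h1 h2
  have hfr : Module.finrank K (Submodule.span K {A • ![x, y, z], A • ![x', y', z']}) = 2 := by
    rw [← Matrix.range_cons_cons_empty _ _ ![], finrank_span_eq_card hli, Fintype.card_fin]
  have key := ncard_inter_span (U := U) hli
  have h2 : ∀ t, HasPoint U (A • ![x, y, z] + t • A • ![x', y', z']) ↔
      HasCoords U A (x + t * x') (y + t * y') (z + t * z') := by
    intro t
    rw [HasCoords, ← gl_smul_smul, ← smul_add]
    simp
  simp only [h2] at key
  have h3 := hU.2 ⟨_, hfr⟩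
  rw [show PlaneLine.points ⟨_, hfr⟩ = {P : PlanePoint K | P.submodule ≤
    Submodule.span K {A • ![x, y, z], A • ![x', y', z']}} from rfl, key] at h3
  exact h3

lemma IsUnital.ncard_line_of_hasCoords {q : ℕ} [Fintype K] (hU : IsUnital q U) {x y z x' y' z' : K}
    (h : ∀ s t, s * x + t * x' = 0 → s * y + t * y' = 0 → s * z + t * z' = 0 → s = 0 ∧ t = 0)
    (h' : HasCoords U A x' y' z') :
    {t | HasCoords U A (x + t * x') (y + t * y') (z + t * z')}.ncard = 0 ∨
    {t | HasCoords U A (x + t * x') (y + t * y') (z + t * z')}.ncard = q := by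
  classical
  have := hU.ncard_line (A := A) h
  rw [if_pos h'] at this
  omega

lemma IsUnital.ncard_line_of_not_hasCoords {q : ℕ} [Fintype K] (hU : IsUnital q U)
    {x y z x' y' z' : K}
    (h : ∀ s t, s * x + t * x' = 0 → s * y + t * y' = 0 → s * z + t * z' = 0 → s = 0 ∧ t = 0)
    (h' : ¬ HasCoords U A x' y' z') :
    {t | HasCoords U A (x + t * x') (y + t * y') (z + t * z')}.ncard = 1 ∨
    {t | HasCoords U A (x + t * x') (y + t * y') (z + t * z')}.ncard = q + 1 := by
  classical
  have := hU.ncard_line (A := A) h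
  rw [if_neg h'] at this
  omega

open Classical in
/-- The points of `U` are counted along the lines through the first point of the frame. -/
lemma ncard_eq_sum_rows [Fintype K] (A : Matrix.GeneralLinearGroup (Fin 3) K) :
    U.ncard = ∑ s, {x | HasCoords U A x 1 s}.ncard + {x | HasCoords U A x 0 1}.ncard +
      if HasCoords U A 1 0 0 then 1 else 0 := by
  let N : (K × K) ⊕ K ⊕ Unit → Fin 3 → K := Sum.elim (fun p => ![p.2, 1, p.1])
    (Sum.elim (fun x => ![x, 0, 1]) fun _ => ![1, 0, 0])
  have hN : ∀ o, A • N o ≠ 0 := by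
    intro o
    rw [ne_eq, smul_eq_zero_iff_eq]
    rintro h
    have h0 := congrFun h 0
    have h1 := congrFun h 1
    have h2 := congrFun h 2
    rcases o with ⟨s, x⟩ | x | _ <;> simp [N] at h0 h1 h2
  let F : (K × K) ⊕ K ⊕ Unit → PlanePoint K := fun o => Projectivization.mk K (A • N o) (hN o)
  have hF : Function.Injective F := by
    intro o o' h
    obtain ⟨a, ha⟩ := (Projectivization.mk_eq_mk_iff' K _ _ _ _).mp h
    rw [← gl_smul_smul, smul_left_cancel_iff] at ha
    have h0 := congrFun ha 0
    have h1 := congrFun ha 1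
    have h2 := congrFun ha 2
    rcases o with ⟨s, x⟩ | x | _ <;> rcases o' with ⟨s', x'⟩ | x' | _ <;>
      simp only [N, Sum.elim_inl, Sum.elim_inr, Pi.smul_apply, smul_eq_mul, Matrix.cons_val,
        mul_one, mul_zero] at h0 h1 h2 <;> simp_all
    exact zero_ne_one ((zero_mul s').symm.trans (h0 ▸ h2))
  have hr : Set.range F = Set.univ := by
    rw [Set.eq_univ_iff_forall]
    intro P
    induction P using Projectivization.ind with | _ v hv =>
    obtain ⟨w, rfl⟩ : ∃ w, A • w = v := ⟨A⁻¹ • v, smul_inv_smul A v⟩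
    have hw : w = ![w 0, w 1, w 2] := by
      ext i; fin_cases i <;> rfl
    have hw0 : w ≠ 0 := by
      rintro rfl
      exact hv (smul_zero A)
    by_cases h1 : w 1 = 0
    · by_cases h2 : w 2 = 0
      · have h0 : w 0 ≠ 0 := by
          intro h0
          apply hw0
          rw [hw, h0, h1, h2]
          ext i; fin_cases i <;> rfl
        refine ⟨Sum.inr (Sum.inr ()), (Projectivization.mk_eq_mk_iff' K _ _ _ _).mpr
          ⟨(w 0)⁻¹, ?_⟩⟩
        rw [← gl_smul_smul, hw, h1, h2]
        simp [N, h0]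
      · refine ⟨Sum.inr (Sum.inl ((w 2)⁻¹ * w 0)), (Projectivization.mk_eq_mk_iff' K _ _ _ _).mpr
          ⟨(w 2)⁻¹, ?_⟩⟩
        rw [← gl_smul_smul, hw, h1]
        simp [N, h2]
    · refine ⟨Sum.inl ((w 1)⁻¹ * w 2, (w 1)⁻¹ * w 0),
        (Projectivization.mk_eq_mk_iff' K _ _ _ _).mpr
        ⟨(w 1)⁻¹, ?_⟩⟩
      rw [← gl_smul_smul, hw]
      simp [N, h1]
  have key := ncard_inter_range U hF
  rw [hr, Set.inter_univ] at key
  have h1 : ∀ o, (F o ∈ U) = HasPoint U (A • N o) := fun o => propext (hasPoint_iff (hN o)).symm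
  simp_rw [h1] at key
  rw [key, Fintype.sum_sum_type, Fintype.sum_sum_type, Fintype.sum_prod_type, ← add_assoc]
  congr 1
  · congr 1
    · refine Finset.sum_congr rfl fun s _ => ?_
      rw [ncard_eq_card_filter, Finset.sum_boole, Nat.cast_id]
      rfl
    · rw [ncard_eq_card_filter, Finset.sum_boole, Nat.cast_id]
      rfl

end Points

/-! ### Tangent frames -/

/-- The columns of `A` are coordinate vectors of points `P`, `R`, `Q` such that `P` and `Q` belong
to the unital `U` and `R` is the intersection of the tangents at `P` and `Q`. -/
structure IsTangentFrame {K : Type*} [Field K] (q : ℕ) (U : Set (PlanePoint K))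
    (A : Matrix.GeneralLinearGroup (Fin 3) K) : Prop where
  left_mem : HasCoords U A 1 0 0
  right_mem : HasCoords U A 0 0 1
  left_tangent : ∀ x, ¬ HasCoords U A x 1 0
  right_tangent : ∀ z, ¬ HasCoords U A 0 1 z
  card_left : ∀ s, s ≠ 0 → {x | HasCoords U A x 1 s}.ncard = q
  card_right : ∀ r, r ≠ 0 → {z | HasCoords U A r 1 z}.ncard = q

section Frames

variable {K : Type*} [Field K] {U : Set (PlanePoint K)} {q : ℕ}

lemma exists_gl_smul (M : Matrix (Fin 3) (Fin 3) K) (hM : M.det ≠ 0) :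
    ∃ B : Matrix.GeneralLinearGroup (Fin 3) K, ∀ v : Fin 3 → K, B • v = M.mulVec v :=
  ⟨Matrix.GeneralLinearGroup.mkOfDetNeZero M hM, fun _ => rfl⟩

lemma exists_frame_swap (A : Matrix.GeneralLinearGroup (Fin 3) K) :
    ∃ B : Matrix.GeneralLinearGroup (Fin 3) K, ∀ x y z,
      HasCoords U B x y z ↔ HasCoords U A z y x := by
  obtain ⟨S, hS⟩ := exists_gl_smul (!![0, 0, 1; 0, 1, 0; 1, 0, 0] : Matrix (Fin 3) (Fin 3) K)
    (by simp [Matrix.det_fin_three])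
  refine ⟨A * S, fun x y z => ?_⟩
  have h : S • ![x, y, z] = ![z, y, x] := by
    rw [hS]
    ext i
    fin_cases i <;> simp [Matrix.mulVec, dotProduct, Fin.sum_univ_three]
  rw [HasCoords, mul_smul, h, HasCoords]

/-- Among the lines through `P` different from `P Q`, exactly one is a tangent. -/
lemma IsUnital.exists_row_eq_zero [Fintype K] (hU : IsUnital q U) (hcard : Fintype.card K = q ^ 2)
    {A : Matrix.GeneralLinearGroup (Fin 3) K} (h₁ : HasCoords U A 1 0 0)
    (h₂ : HasCoords U A 0 0 1) :
    ∃ s₀, {x | HasCoords U A x 1 s₀}.ncard = 0 ∧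
      ∀ s, s ≠ s₀ → {x | HasCoords U A x 1 s}.ncard = q := by
  classical
  have hq := one_lt_of_card_eq_sq hcard
  have hrow : ∀ s, {x | HasCoords U A x 1 s}.ncard = 0 ∨ {x | HasCoords U A x 1 s}.ncard = q := by
    intro s
    simpa using hU.ncard_line_of_hasCoords (A := A) (x := 0) (y := 1) (z := s)
      (fun a b e1 e2 e3 => by simp at e1 e2; exact ⟨e2, e1⟩) h₁
  have hinf : {x | HasCoords U A x 0 1}.ncard = q := by
    have h3 : {x | HasCoords U A x 0 1}.ncard = 0 ∨ {x | HasCoords U A x 0 1}.ncard = q := by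
      simpa using hU.ncard_line_of_hasCoords (A := A) (x := 0) (y := 0) (z := 1)
        (fun a b e1 e2 e3 => by simp at e1 e3; exact ⟨e3, e1⟩) h₁
    refine h3.resolve_left fun h => ?_
    rw [Set.ncard_eq_zero] at h
    have : (0 : K) ∈ {x | HasCoords U A x 0 1} := h₂
    rw [h] at this
    exact this
  have hsum := ncard_eq_sum_rows (U := U) A
  rw [hU.1, hinf, if_pos h₁] at hsum
  have hcount : q * (Finset.univ.filter fun s => {x | HasCoords U A x 1 s}.ncard = 0).card +
      ∑ s, {x | HasCoords U A x 1 s}.ncard = q * q ^ 2 := by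
    rw [Finset.card_filter, Finset.mul_sum, ← Finset.sum_add_distrib, ← hcard, mul_comm,
      ← smul_eq_mul (Fintype.card K), ← Finset.card_univ, ← Finset.sum_const]
    refine Finset.sum_congr rfl fun s _ => ?_
    rcases hrow s with h | h
    · rw [h]; simp
    · rw [h, if_neg (by omega)]; simp
  have hone : (Finset.univ.filter fun s => {x | HasCoords U A x 1 s}.ncard = 0).card = 1 := by
    have : q ^ 3 = q * q ^ 2 := by ring
    refine Nat.eq_of_mul_eq_mul_left (show 0 < q by omega) ?_
    omega
  obtain ⟨s₀, hs₀⟩ := Finset.card_eq_one.mp hone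
  have hmem : ∀ s, {x | HasCoords U A x 1 s}.ncard = 0 ↔ s = s₀ := by
    intro s
    simpa using congrArg (s ∈ ·) hs₀
  exact ⟨s₀, (hmem s₀).mpr rfl, fun s hs => (hrow s).resolve_left fun h => hs ((hmem s).mp h)⟩

/-- Any two points of a unital belong to a tangent frame. -/
theorem IsUnital.exists_isTangentFrame [Fintype K] (hU : IsUnital q U)
    (hcard : Fintype.card K = q ^ 2) {P Q : PlanePoint K} (hP : P ∈ U) (hQ : Q ∈ U) (hPQ : P ≠ Q) :
    ∃ A, IsTangentFrame q U A ∧ (∃ h, Projectivization.mk K (A • ![1, 0, 0]) h = P) ∧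
      ∃ h, Projectivization.mk K (A • ![0, 0, 1]) h = Q := by
  have h100 : (![1, 0, 0] : Fin 3 → K) ≠ 0 := fun h => by simpa using congrFun h 0
  have h001 : (![0, 0, 1] : Fin 3 → K) ≠ 0 := fun h => by simpa using congrFun h 2
  have hne : Projectivization.mk K ![1, 0, 0] h100 ≠ Projectivization.mk K ![0, 0, 1] h001 := by
    intro h
    obtain ⟨a, ha⟩ := (Projectivization.mk_eq_mk_iff' K _ _ _ _).mp h
    simpa using congrFun ha 0
  obtain ⟨g, hgP, hgQ⟩ := (MulAction.is_two_pretransitive_iff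
    (G := Matrix.SpecialLinearGroup (Fin 3) K)).mp inferInstance hne hPQ
  let A₀ : Matrix.GeneralLinearGroup (Fin 3) K := Matrix.SpecialLinearGroup.toGL g
  have hA₀ : ∀ v : Fin 3 → K, A₀ • v = g • v := fun _ => rfl
  have hP0 : ∃ h, Projectivization.mk K (A₀ • ![1, 0, 0]) h = P :=
    ⟨by rw [ne_eq, smul_eq_zero_iff_eq]; exact h100, hgP⟩
  have hQ0 : ∃ h, Projectivization.mk K (A₀ • ![0, 0, 1]) h = Q :=
    ⟨by rw [ne_eq, smul_eq_zero_iff_eq]; exact h001, hgQ⟩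
  have h₁ : HasCoords U A₀ 1 0 0 := ⟨hP0.1, by rw [hP0.2]; exact hP⟩
  have h₂ : HasCoords U A₀ 0 0 1 := ⟨hQ0.1, by rw [hQ0.2]; exact hQ⟩
  obtain ⟨s₀, hs₀, hs⟩ := hU.exists_row_eq_zero hcard h₁ h₂
  obtain ⟨B, hB⟩ := exists_frame_swap (U := U) A₀
  obtain ⟨x₀, hx₀, hx⟩ := hU.exists_row_eq_zero hcard (A := B) ((hB _ _ _).mpr h₂)
    ((hB _ _ _).mpr h₁)
  simp only [hB] at hx₀ hx
  rw [Set.ncard_eq_zero, Set.eq_empty_iff_forall_notMem] at hs₀ hx₀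
  obtain ⟨S, hS⟩ := exists_gl_smul (!![1, x₀, 0; 0, 1, 0; 0, s₀, 1] : Matrix (Fin 3) (Fin 3) K)
    (by simp [Matrix.det_fin_three])
  have hS' : ∀ x y z, S • ![x, y, z] = ![x + x₀ * y, y, s₀ * y + z] := by
    intro x y z
    rw [hS]
    ext i
    fin_cases i <;> simp [Matrix.mulVec, dotProduct, Fin.sum_univ_three]
  have hA : ∀ x y z, HasCoords U (A₀ * S) x y z ↔ HasCoords U A₀ (x + x₀ * y) y (s₀ * y + z) := by
    intro x y z
    rw [HasCoords, mul_smul, hS', HasCoords]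
  have htrans : ∀ (x : K) (p : K → Prop), {y | p (y + x)}.ncard = {y | p y}.ncard := by
    intro x p
    exact Set.ncard_preimage_of_injective_subset_range (s := {y | p y}) (add_left_injective x)
      (by rw [(add_right_surjective x).range_eq]; exact Set.subset_univ _)
  refine ⟨A₀ * S, ⟨?_, ?_, fun x => ?_, fun z => ?_, fun s h => ?_, fun r h => ?_⟩, ?_, ?_⟩
  · rw [hA]; simpa using h₁
  · rw [hA]; simpa using h₂
  · rw [hA]; simpa using hs₀ (x + x₀)
  · rw [hA]; simpa [add_comm] using hx₀ (s₀ + z)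
  · simp only [hA, mul_one]
    rw [htrans x₀ fun y => HasCoords U A₀ y 1 (s₀ + s)]
    exact hs _ (by simpa using h)
  · simp only [hA, mul_one, add_comm s₀]
    rw [htrans s₀ fun y => HasCoords U A₀ (r + x₀) 1 y]
    exact hx _ (by simpa using h)
  · simp only [mul_smul, hS']
    simpa using hP0
  · simp only [mul_smul, hS']
    simpa using hQ0

namespace IsTangentFrame

variable {A : Matrix.GeneralLinearGroup (Fin 3) K}

lemma hasCoords_zero (hA : IsTangentFrame q U A) (y z : K) :
    HasCoords U A 0 y z ↔ y = 0 ∧ z ≠ 0 := by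
  by_cases hy : y = 0
  · subst hy
    by_cases hz : z = 0
    · subst hz
      have : (![0, 0, 0] : Fin 3 → K) = 0 := by ext i; fin_cases i <;> rfl
      simp [HasCoords, HasPoint, this]
    · have := hasCoords_mul (U := U) (A := A) hz (x := 0) (y := 0) (z := 1)
      rw [mul_zero, mul_one] at this
      simp [this, hA.right_mem, hz]
  · have := hasCoords_mul (U := U) (A := A) hy (x := 0) (y := 1) (z := y⁻¹ * z)
    rw [mul_zero, mul_one, mul_inv_cancel_left₀ hy] at this
    simp [this, hA.right_tangent, hy]

/-- The counting conditions in the chart are the intersections of the unital with its lines. -/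
lemma isUnitalChart [Fintype K] (hU : IsUnital q U) (hcard : Fintype.card K = q ^ 2)
    (hA : IsTangentFrame q U A) : IsUnitalChart q (HasCoords U A 1) := by
  have hq := one_lt_of_card_eq_sq hcard
  have hmul : ∀ {a : K}, a ≠ 0 → ∀ p : K → Prop, {y | p (a * y)}.ncard = {y | p y}.ncard := by
    intro a ha p
    exact Set.ncard_preimage_of_injective_subset_range (s := {y | p y}) (mul_right_injective₀ ha)
      (by rw [(mul_left_surjective₀ ha).range_eq]; exact Set.subset_univ _)
  refine ⟨fun y => ?_, fun w => ?_, fun y => ?_, fun γ hγ => ?_, fun α γ hα hγ => ?_⟩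
  · refine ⟨fun h => ?_, ?_⟩
    · by_contra hy
      have := hasCoords_mul (U := U) (A := A) hy (x := y⁻¹) (y := 1) (z := 0)
      rw [mul_zero, mul_one, mul_inv_cancel₀ hy] at this
      exact hA.left_tangent _ (this.mp h)
    · rintro rfl
      exact hA.left_mem
  · simpa using hU.ncard_line_of_not_hasCoords (A := A) (x := 1) (y := 0) (z := w)
      (fun a b e1 e2 e3 => by simp at e1 e2; exact ⟨e1, e2⟩) (hA.right_tangent 0)
  · by_cases hy : y = 0
    · subst hy
      have h3 : {w | HasCoords U A 1 0 w}.ncard = 0 ∨ {w | HasCoords U A 1 0 w}.ncard = q := by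
        simpa using hU.ncard_line_of_hasCoords (A := A) (x := 1) (y := 0) (z := 0)
          (fun a b e1 e2 e3 => by simp at e1 e3; exact ⟨e1, e3⟩) hA.right_mem
      refine h3.resolve_left fun h => ?_
      rw [Set.ncard_eq_zero] at h
      have : (0 : K) ∈ {w | HasCoords U A 1 0 w} := hA.left_mem
      rw [h] at this
      exact this
    · rw [← hA.card_right y⁻¹ (inv_ne_zero hy), ← hmul hy fun w => HasCoords U A 1 y w]
      congr 1
      ext w
      have := hasCoords_mul (U := U) (A := A) hy (x := y⁻¹) (y := 1) (z := w)
      rw [mul_one, mul_inv_cancel₀ hy] at this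
      exact this
  · rw [← hA.card_left γ⁻¹ (inv_ne_zero hγ)]
    refine Set.ncard_congr (fun w _ => (γ * w)⁻¹) ?_ ?_ ?_
    · rintro w ⟨hw, h⟩
      have h1 := mul_ne_zero hγ hw
      have := hasCoords_mul (U := U) (A := A) h1 (x := (γ * w)⁻¹) (y := 1) (z := γ⁻¹)
      rw [mul_inv_cancel₀ h1, mul_one, mul_comm γ w, mul_inv_cancel_right₀ hγ, mul_comm w] at this
      exact this.mp h
    · intro w w' _ _ h
      exact mul_left_cancel₀ hγ (inv_injective h)
    · intro x hx
      have hx0 : x ≠ 0 := by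
        rintro rfl
        exact hA.right_tangent _ hx
      have h1 := mul_ne_zero hγ hx0
      refine ⟨(γ * x)⁻¹, ⟨inv_ne_zero h1, ?_⟩, ?_⟩
      · have := hasCoords_mul (U := U) (A := A) (inv_ne_zero hx0) (x := x) (y := 1) (z := γ⁻¹)
        rw [inv_mul_cancel₀ hx0, mul_one] at this
        have h2 := this.mpr hx
        rwa [mul_inv, mul_inv_cancel_left₀ hγ, mul_comm γ⁻¹]
      · field_simp
  · have hnot : ¬ HasCoords U A 0 γ 1 := by
      rw [hA.hasCoords_zero]
      exact fun h => hγ h.1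
    simpa [mul_comm] using hU.ncard_line_of_not_hasCoords (A := A) (x := 1) (y := α) (z := 0)
      (fun a b e1 e2 e3 => by simp at e1 e3; exact ⟨e1, e3⟩) hnot

end IsTangentFrame

end Frames

/-! ### The stabilizer of two points of a unital -/

section Stabilizer

variable {K : Type*} [Field K] {U : Set (PlanePoint K)} {q : ℕ}

lemma mk_mem_projectivityGroup {G : Matrix.GeneralLinearGroup (Fin 3) K} :
    Matrix.ProjGenLinGroup.mk G ∈ projectivityGroup U ↔ ∀ v, HasPoint U (G • v) ↔ HasPoint U v := by
  rw [projectivityGroup, MulAction.mem_stabilizer_set]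
  constructor
  · intro h v
    by_cases hv : v = 0
    · simp [hv]
    · rw [hasPoint_iff hv, hasPoint_iff ((smul_ne_zero_iff_ne G).mpr hv),
        ← h (Projectivization.mk K v hv)]
      rfl
  · intro h P
    induction P using Projectivization.ind with | _ v hv =>
    rw [Projectivization.PGL.mk_smul_mk, ← hasPoint_iff, ← hasPoint_iff, h]

lemma gl_ext {G G' : Matrix.GeneralLinearGroup (Fin 3) K} (h : ∀ v : Fin 3 → K, G • v = G' • v) :
    G = G' :=
  Units.ext (Matrix.ext_iff_smul.mpr h)

lemma mul_scalar_smul (G : Matrix.GeneralLinearGroup (Fin 3) K) (u : Kˣ) (v : Fin 3 → K) :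
    (G * Matrix.GeneralLinearGroup.scalar (Fin 3) u) • v = (u : K) • G • v := by
  rw [mul_smul, ← gl_smul_smul]
  congr 1
  simp [Units.smul_def]

lemma exists_diagonal_smul (A : Matrix.GeneralLinearGroup (Fin 3) K) (g : Kˣ × Kˣ) :
    ∃ D : Matrix.GeneralLinearGroup (Fin 3) K, ∀ x y z : K,
      D • A • ![x, y, z] = A • ![x, g.1 * y, g.2 * z] := by
  obtain ⟨S, hS⟩ := exists_gl_smul (!![1, 0, 0; 0, g.1, 0; 0, 0, g.2] : Matrix (Fin 3) (Fin 3) K)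
    (by simp [Matrix.det_fin_three])
  refine ⟨A * S * A⁻¹, fun x y z => ?_⟩
  rw [mul_smul, inv_smul_smul, mul_smul, hS]
  congr 1
  ext i
  fin_cases i <;> simp [Matrix.mulVec, dotProduct, Fin.sum_univ_three]

lemma eq_vec (A : Matrix.GeneralLinearGroup (Fin 3) K) (v : Fin 3 → K) :
    ∃ x y z, v = A • ![x, y, z] := by
  refine ⟨(A⁻¹ • v) 0, (A⁻¹ • v) 1, (A⁻¹ • v) 2, ?_⟩
  rw [← inv_smul_eq_iff]
  ext i
  fin_cases i <;> rfl

/-- A projectivity fixing `P`, `Q` and the unital fixes the tangents at `P` and `Q`, so that it is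
diagonal with respect to a tangent frame. -/
theorem IsTangentFrame.card_twoPointStabilizer [Fintype K] (hq : 0 < q)
    {A : Matrix.GeneralLinearGroup (Fin 3) K} (hA : IsTangentFrame q U A) {P Q : PlanePoint K}
    (hP : ∃ h, Projectivization.mk K (A • ![1, 0, 0]) h = P)
    (hQ : ∃ h, Projectivization.mk K (A • ![0, 0, 1]) h = Q) :
    Nat.card (twoPointStabilizer U P Q) = Nat.card (chartGroup (HasCoords U A 1)) := by
  choose D hD using exists_diagonal_smul A
  obtain ⟨hP0, hP⟩ := hP
  obtain ⟨hQ0, hQ⟩ := hQ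
  have hD1 : ∀ g ∈ chartGroup (HasCoords U A 1),
      Matrix.ProjGenLinGroup.mk (D g) ∈ projectivityGroup U := by
    intro g hg
    rw [mk_mem_projectivityGroup]
    intro v
    obtain ⟨x, y, z, rfl⟩ := eq_vec A v
    rw [hD]
    change HasCoords U A _ _ _ ↔ HasCoords U A _ _ _
    by_cases hx : x = 0
    · rw [hx, hA.hasCoords_zero, hA.hasCoords_zero]
      simp
    · rw [← hasCoords_mul (inv_ne_zero hx), ← hasCoords_mul (inv_ne_zero hx) (y := y),
        inv_mul_cancel₀ hx, mul_left_comm, mul_left_comm (x⁻¹) (g.2 : K)]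
      exact (mem_chartGroup.mp hg _ _).symm
  have hDP : ∀ g, Matrix.ProjGenLinGroup.mk (D g) • P = P := by
    intro g
    rw [← hP, Projectivization.PGL.mk_smul_mk, Projectivization.mk_eq_mk_iff']
    exact ⟨1, by rw [hD]; simp⟩
  have hDQ : ∀ g, Matrix.ProjGenLinGroup.mk (D g) • Q = Q := by
    intro g
    rw [← hQ, Projectivization.PGL.mk_smul_mk, Projectivization.mk_eq_mk_iff']
    exact ⟨g.2, by rw [hD, ← gl_smul_smul]; simp⟩
  let F : chartGroup (HasCoords U A 1) → twoPointStabilizer U P Q := fun g =>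
    ⟨⟨Matrix.ProjGenLinGroup.mk (D g), hD1 g g.2⟩, hDP g, hDQ g⟩
  refine (Nat.card_congr (Equiv.ofBijective F ⟨fun g g' h => ?_, ?_⟩)).symm
  · have h1 : Matrix.ProjGenLinGroup.mk (D g) = Matrix.ProjGenLinGroup.mk (D g') :=
      congrArg (fun k : twoPointStabilizer U P Q => (k : projectivityGroup U).1) h
    obtain ⟨u, hu⟩ := Matrix.ProjGenLinGroup.mk_eq_mk_iff.mp h1
    have h2 := congrArg (fun k : Matrix.GeneralLinearGroup (Fin 3) K => k • A • ![(1 : K), 1, 1]) hu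
    rw [mul_scalar_smul, hD, hD, ← gl_smul_smul, smul_left_cancel_iff] at h2
    have e0 := congrFun h2 0
    have e1 := congrFun h2 1
    have e2 := congrFun h2 2
    simp at e0 e1 e2
    simp [e0] at e1 e2
    exact Subtype.ext (Prod.ext (Units.ext e1) (Units.ext e2))
  · rintro ⟨⟨g, hg⟩, hgP, hgQ⟩
    induction g using Matrix.ProjGenLinGroup.induction_on with | mk G =>
    have hGU := mk_mem_projectivityGroup.mp hg
    have hgP' : Matrix.ProjGenLinGroup.mk G • P = P := hgP
    have hgQ' : Matrix.ProjGenLinGroup.mk G • Q = Q := hgQ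
    rw [← hP, Projectivization.PGL.mk_smul_mk, Projectivization.mk_eq_mk_iff'] at hgP'
    rw [← hQ, Projectivization.PGL.mk_smul_mk, Projectivization.mk_eq_mk_iff'] at hgQ'
    obtain ⟨α, hα⟩ := hgP'
    obtain ⟨β, hβ⟩ := hgQ'
    obtain ⟨x, m, z, hm⟩ := eq_vec A (G • A • ![0, 1, 0])
    have hα0 : α ≠ 0 := by
      rintro rfl
      rw [zero_smul] at hα
      exact (smul_ne_zero_iff_ne G).mpr hP0 hα.symm
    have hβ0 : β ≠ 0 := by
      rintro rfl
      rw [zero_smul] at hβ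
      exact (smul_ne_zero_iff_ne G).mpr hQ0 hβ.symm
    have hG : ∀ a b c, G • A • ![a, b, c] = A • ![α * a + x * b, m * b, z * b + β * c] := by
      intro a b c
      have h1 : ![a, b, c] = a • ![1, 0, 0] + b • ![0, 1, 0] + c • ![0, 0, 1] := by
        ext i; fin_cases i <;> simp
      rw [h1, smul_add, smul_add, smul_add, smul_add, gl_smul_smul, gl_smul_smul, gl_smul_smul,
        gl_smul_smul, gl_smul_smul, gl_smul_smul, hm, ← hα, ← hβ, ← gl_smul_smul, ← gl_smul_smul,
        ← gl_smul_smul, ← gl_smul_smul, ← gl_smul_smul, ← smul_add, ← smul_add]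
      congr 1
      ext i; fin_cases i <;> simp <;> ring
    have hm0 : m ≠ 0 := by
      rintro rfl
      have h1 := hG (-(α⁻¹ * x)) 1 (-(β⁻¹ * z))
      have h2 : ![α * -(α⁻¹ * x) + x * 1, 0 * 1, z * 1 + β * -(β⁻¹ * z)] = 0 := by
        ext i; fin_cases i <;> simp [hα0, hβ0]
      rw [h2, smul_zero, smul_eq_zero_iff_eq, smul_eq_zero_iff_eq] at h1
      simpa using congrFun h1 1
    have hGU' : ∀ a b c, HasCoords U A (α * a + x * b) (m * b) (z * b + β * c) ↔
        HasCoords U A a b c := by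
      intro a b c
      rw [HasCoords, ← hG]
      exact hGU _
    have hz : z = 0 := by
      by_contra hz
      have h1 := hA.card_left (m⁻¹ * z) (mul_ne_zero (inv_ne_zero hm0) hz)
      obtain ⟨t, ht⟩ : {x | HasCoords U A x 1 (m⁻¹ * z)}.Nonempty := by
        rw [← Set.ncard_pos, h1]; exact hq
      refine hA.left_tangent (α⁻¹ * (m * t - x)) ((hGU' _ _ _).mp ?_)
      rw [← hasCoords_mul (inv_ne_zero hm0)]
      rw [mul_inv_cancel_left₀ hα0, mul_one, mul_one, mul_one, sub_add_cancel,
        inv_mul_cancel_left₀ hm0, inv_mul_cancel₀ hm0, mul_zero, add_zero]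
      exact ht
    have hx : x = 0 := by
      by_contra hx
      have h1 := hA.card_right (m⁻¹ * x) (mul_ne_zero (inv_ne_zero hm0) hx)
      obtain ⟨t, ht⟩ : {z | HasCoords U A (m⁻¹ * x) 1 z}.Nonempty := by
        rw [← Set.ncard_pos, h1]; exact hq
      refine hA.right_tangent (β⁻¹ * (m * t - z)) ((hGU' _ _ _).mp ?_)
      rw [← hasCoords_mul (inv_ne_zero hm0)]
      rw [mul_inv_cancel_left₀ hβ0, mul_one, mul_one, mul_one, add_sub_cancel,
        inv_mul_cancel_left₀ hm0, inv_mul_cancel₀ hm0, mul_zero, zero_add]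
      exact ht
    subst hz hx
    simp only [zero_mul, add_zero, zero_add] at hGU' hG
    refine ⟨⟨(Units.mk0 (α⁻¹ * m) (mul_ne_zero (inv_ne_zero hα0) hm0),
      Units.mk0 (α⁻¹ * β) (mul_ne_zero (inv_ne_zero hα0) hβ0)), ?_⟩, ?_⟩
    · rw [mem_chartGroup]
      intro y w
      rw [← hGU', ← hasCoords_mul (inv_ne_zero hα0), mul_one, inv_mul_cancel₀ hα0, ← mul_assoc,
        ← mul_assoc]
      rfl
    · refine Subtype.ext (Subtype.ext ?_)
      refine Matrix.ProjGenLinGroup.mk_eq_mk_iff.mpr ⟨Units.mk0 α hα0, gl_ext fun v => ?_⟩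
      obtain ⟨a, b, c, rfl⟩ := eq_vec A v
      rw [mul_scalar_smul, hD, hG, ← gl_smul_smul]
      congr 1
      ext i; fin_cases i <;> simp [hα0, mul_assoc]

end Stabilizer

/-! ### Hermitian forms -/

section Hermitian

open Matrix

variable {K : Type*} [Field K] [Fintype K] {q : ℕ} {U : Set (PlanePoint K)}

lemma exists_ringHom_pow_q (hcard : Fintype.card K = q ^ 2) : ∃ σ : K →+* K, ∀ x, σ x = x ^ q := by
  obtain ⟨p, h, hp, _, -, rfl⟩ := exists_prime_pow_eq hcard
  have := Fact.mk hp
  exact ⟨iterateFrobenius K p h, fun x => iterateFrobenius_def p h x⟩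

lemma unitaryPairing_eq_dotProduct {K : Type*} [Field K] {q : ℕ} {σ : K →+* K}
    (hσ : ∀ x, σ x = x ^ q)
    (H : Matrix (Fin 3) (Fin 3) K) (x y : Fin 3 → K) :
    unitaryPairing q H x y = (σ ∘ x) ⬝ᵥ (H *ᵥ y) := by
  simp only [unitaryPairing, dotProduct, mulVec, Function.comp_apply, hσ, Finset.mul_sum, mul_assoc]

/-- A classical unital is the set of isotropic points of a nondegenerate Hermitian form. -/
lemma isClassicalUnital_iff (hcard : Fintype.card K = q ^ 2) :
    IsClassicalUnital q U ↔ ∃ H : Matrix (Fin 3) (Fin 3) K, (∀ i j, H j i = H i j ^ q) ∧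
      IsUnit H.det ∧ ∀ v ≠ 0, (HasPoint U v ↔ unitaryPairing q H v v = 0) := by
  constructor
  · rintro ⟨π, ⟨H, hH, hdet, hπ⟩, rfl⟩
    refine ⟨H, hH, hdet, fun v hv => ?_⟩
    rw [hasPoint_iff hv, ← hπ v hv]
    change (Projectivization.mk K v hv).submodule ≤ _ ↔ _
    rw [Projectivization.submodule_mk, Submodule.span_singleton_le_iff_mem]
  · rintro ⟨H, hH, hdet, hU⟩
    obtain ⟨σ, hσ⟩ := exists_ringHom_pow_q hcard
    let φ : (Fin 3 → K) → Module.Dual K (Fin 3 → K) := fun v =>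
      { toFun := unitaryPairing q H v
        map_add' := fun x y => by
          simp only [unitaryPairing_eq_dotProduct hσ, mulVec_add, dotProduct_add]
        map_smul' := fun a x => by
          simp only [unitaryPairing_eq_dotProduct hσ, mulVec_smul, dotProduct_smul,
            RingHom.id_apply] }
    have hφ : ∀ v, v ≠ 0 → φ v ≠ 0 := by
      intro v hv h
      have h1 : (σ ∘ v) ᵥ* H = 0 := by
        refine dotProduct_eq_zero _ fun w => ?_
        rw [← dotProduct_mulVec, ← unitaryPairing_eq_dotProduct hσ]
        exact LinearMap.congr_fun h w
      have h2 := eq_zero_of_vecMul_eq_zero hdet.ne_zero h1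
      refine hv (funext fun i => ?_)
      have h3 : σ (v i) = 0 := congrFun h2 i
      simpa using h3
    have hrank : ∀ P : PlanePoint K, Module.finrank K (LinearMap.ker (φ P.rep)) = 2 := by
      intro P
      have := Module.Dual.finrank_ker_add_one_of_ne_zero (hφ _ P.rep_nonzero)
      rw [Module.finrank_fin_fun] at this
      omega
    have hπ : ∀ (v : Fin 3 → K) (hv : v ≠ 0) (w : Fin 3 → K),
        w ∈ LinearMap.ker (φ (Projectivization.mk K v hv).rep) ↔ unitaryPairing q H v w = 0 := by
      intro v hv w
      obtain ⟨a, ha⟩ := Projectivization.exists_smul_eq_mk_rep K v hv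
      rw [LinearMap.mem_ker, ← ha]
      change unitaryPairing q H (a • v) w = 0 ↔ _
      have : unitaryPairing q H (a • v) w = (a : K) ^ q * unitaryPairing q H v w := by
        simp only [unitaryPairing, Finset.mul_sum, Pi.smul_apply, Units.smul_def, smul_eq_mul,
          mul_pow, mul_assoc]
      rw [this, mul_eq_zero, or_iff_right (pow_ne_zero q a.ne_zero)]
    refine ⟨fun P => ⟨_, hrank P⟩, ⟨H, hH, hdet, hπ⟩, ?_⟩
    ext P
    induction P using Projectivization.ind with | _ v hv =>
    rw [← hasPoint_iff hv, hU v hv, ← hπ v hv]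
    change _ ↔ (Projectivization.mk K v hv).submodule ≤ _
    rw [Projectivization.submodule_mk, Submodule.span_singleton_le_iff_mem]

/-- Change of coordinates in a nondegenerate Hermitian form. -/
lemma exists_transport (hcard : Fintype.card K = q ^ 2) {H : Matrix (Fin 3) (Fin 3) K}
    (hH : ∀ i j, H j i = H i j ^ q) (hdet : IsUnit H.det) (A : GL (Fin 3) K) :
    ∃ G : Matrix (Fin 3) (Fin 3) K, (∀ i j, G j i = G i j ^ q) ∧ IsUnit G.det ∧
      ∀ v w, unitaryPairing q G v w = unitaryPairing q H (A • v) (A • w) := by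
  obtain ⟨σ, hσ⟩ := exists_ringHom_pow_q hcard
  have hσσ : ∀ x, σ (σ x) = x := fun x => by rw [hσ, hσ, pow_q_pow_q hcard]
  have hherm : ∀ M : Matrix (Fin 3) (Fin 3) K,
      (∀ i j, M j i = M i j ^ q) ↔ (M.map σ)ᵀ = M := by
    intro M
    simp only [← hσ, ← Matrix.ext_iff, transpose_apply, map_apply]
    exact ⟨fun h i j => (h j i).symm, fun h i j => (h j i).symm⟩
  let B : Matrix (Fin 3) (Fin 3) K := A
  refine ⟨(B.map σ)ᵀ * H * B, ?_, ?_, fun v w => ?_⟩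
  · rw [hherm] at hH ⊢
    have hB : (B.map σ).map σ = B := by
      ext i j
      simp [hσσ]
    rw [Matrix.map_mul, Matrix.map_mul, transpose_map, hB, transpose_mul, transpose_mul, hH,
      transpose_transpose, mul_assoc]
  · rw [det_mul, det_mul, det_transpose]
    have h1 : IsUnit B.det := (isUnit_iff_isUnit_det B).mp A.isUnit
    have h2 : (B.map σ).det = σ B.det := (RingHom.map_det σ B).symm
    rw [h2]
    exact ((h1.map σ).mul hdet).mul h1
  · have hAv : ∀ u : Fin 3 → K, A • u = B *ᵥ u := fun _ => rfl
    have hσv : σ ∘ (B *ᵥ v) = (B.map σ) *ᵥ (σ ∘ v) := by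
      ext i
      exact RingHom.map_mulVec σ B v i
    rw [unitaryPairing_eq_dotProduct hσ, unitaryPairing_eq_dotProduct hσ, hAv, hAv, hσv,
      ← mulVec_mulVec, ← mulVec_mulVec, dotProduct_mulVec, vecMul_transpose]

/-- The notion of a classical unital in the coordinates of a projective frame. -/
lemma isClassicalUnital_iff_frame (hcard : Fintype.card K = q ^ 2) (A : GL (Fin 3) K) :
    IsClassicalUnital q U ↔ ∃ G : Matrix (Fin 3) (Fin 3) K, (∀ i j, G j i = G i j ^ q) ∧
      IsUnit G.det ∧ ∀ v ≠ 0, (HasPoint U (A • v) ↔ unitaryPairing q G v v = 0) := by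
  rw [isClassicalUnital_iff hcard]
  constructor
  · rintro ⟨H, hH, hdet, h⟩
    obtain ⟨G, hG, hGdet, hGH⟩ := exists_transport hcard hH hdet A
    exact ⟨G, hG, hGdet, fun v hv => by rw [hGH, h _ ((smul_ne_zero_iff_ne A).mpr hv)]⟩
  · rintro ⟨G, hG, hdet, h⟩
    obtain ⟨H, hH, hHdet, hGH⟩ := exists_transport hcard hG hdet A⁻¹
    refine ⟨H, hH, hHdet, fun v hv => ?_⟩
    rw [hGH, ← h _ ((smul_ne_zero_iff_ne A⁻¹).mpr hv), smul_inv_smul]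

lemma unitaryPairing_vec {K : Type*} [Field K] {q : ℕ} (G : Matrix (Fin 3) (Fin 3) K) (x y z : K) :
    unitaryPairing q G ![x, y, z] ![x, y, z] =
      x ^ q * (G 0 0 * x + G 0 1 * y + G 0 2 * z) + y ^ q * (G 1 0 * x + G 1 1 * y + G 1 2 * z) +
        z ^ q * (G 2 0 * x + G 2 1 * y + G 2 2 * z) := by
  simp [unitaryPairing, Fin.sum_univ_three]
  ring

namespace IsTangentFrame

variable {A : GL (Fin 3) K}

/-- A unital with a trace equation in the chart of a tangent frame is classical. -/
theorem isClassicalUnital (hcard : Fintype.card K = q ^ 2) (hA : IsTangentFrame q U A) {b : K}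
    (hb : b ≠ 0) (h : ∀ y w, HasCoords U A 1 y w ↔ y ^ (q + 1) = b * w + b ^ q * w ^ q) :
    IsClassicalUnital q U := by
  have hq := one_lt_of_card_eq_sq hcard
  have h0 : (0 : K) ^ q = 0 := zero_pow (by omega)
  rw [isClassicalUnital_iff_frame hcard A]
  refine ⟨!![0, 0, b; 0, -1, 0; b ^ q, 0, 0], fun i j => ?_, ?_, fun v hv => ?_⟩
  · fin_cases i <;> fin_cases j <;> simp [h0, pow_q_pow_q hcard, neg_one_pow_q hcard]
  · rw [isUnit_iff_ne_zero, det_fin_three]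
    simp [hb]
  · have hv3 : v = ![v 0, v 1, v 2] := by
      ext i; fin_cases i <;> rfl
    rw [hv3] at hv ⊢
    generalize v 0 = x, v 1 = y, v 2 = z at hv
    change HasCoords U A x y z ↔ _
    rw [unitaryPairing_vec]
    simp only [of_apply, cons_val', cons_val_fin_one, cons_val]
    by_cases hx : x = 0
    · subst hx
      rw [hA.hasCoords_zero, h0]
      have h1 : y ^ q * (0 * 0 + -1 * y + 0 * z) = -(y ^ (q + 1)) := by ring
      rw [h1]
      by_cases hy : y = 0
      · subst hy
        have hz : z ≠ 0 := by
          rintro rfl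
          apply hv
          ext i; fin_cases i <;> rfl
        simp [hz]
      · simp [hy]
    · have hxq := mul_ne_zero (pow_ne_zero q hx) hx
      have key : x ^ q * (0 * x + 0 * y + b * z) + y ^ q * (0 * x + -1 * y + 0 * z) +
          z ^ q * (b ^ q * x + 0 * y + 0 * z) = -(x ^ q * x) * ((x⁻¹ * y) ^ (q + 1) -
            (b * (x⁻¹ * z) + b ^ q * (x⁻¹ * z) ^ q)) := by
        rw [mul_pow, mul_pow, inv_pow, inv_pow, pow_succ x]
        field_simp
        ring
      rw [key, mul_eq_zero, or_iff_right (neg_ne_zero.mpr hxq), sub_eq_zero,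
        ← hasCoords_mul (inv_ne_zero hx), inv_mul_cancel₀ hx, h]

end IsTangentFrame

/-- The diagonal symmetries of a Hermitian curve in a tangent frame are the pairs
`(h, h ^ (q + 1))`. -/
lemma card_chartGroup {V : K → K → Prop} (hV : IsUnitalChart q V) (hcard : Fintype.card K = q ^ 2)
    {a b : K} (ha : a ≠ 0) (hb : b ≠ 0)
    (h : ∀ y w, V y w ↔ a * y ^ (q + 1) + (b * w + b ^ q * w ^ q) = 0) :
    Nat.card (chartGroup V) = q ^ 2 - 1 := by
  classical
  have hq := one_lt_of_card_eq_sq hcard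
  rw [← hcard, ← Fintype.card_units, ← Nat.card_eq_fintype_card]
  refine (Nat.card_congr (Equiv.ofBijective
    (fun u : Kˣ => (⟨(u, u ^ (q + 1)), ?_⟩ : chartGroup V)) ⟨fun u u' huu => ?_, ?_⟩)).symm
  · rw [mem_chartGroup]
    intro y w
    rw [h, h, Units.val_pow_eq_pow_val, mul_pow, mul_pow, norm_pow_q hcard]
    have hu := pow_ne_zero (q + 1) u.ne_zero
    rw [← mul_right_inj' hu, mul_zero]
    ring_nf
  · exact congrArg (fun g : chartGroup V => (g : Kˣ × Kˣ).1) huu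
  · rintro ⟨⟨k, l⟩, hkl⟩
    refine ⟨k, Subtype.ext (Prod.ext rfl (Units.ext ?_))⟩
    have hkl' := mem_chartGroup.mp hkl
    simp only at hkl' ⊢
    obtain ⟨d, hd0, hd⟩ : {w | w ≠ 0 ∧ V 0 w}.Nonempty := by
      rw [← Set.ncard_pos, hV.ncard_zeros]
      omega
    obtain ⟨w, hw⟩ : {w | V 1 w}.Nonempty := by
      rw [← Set.ncard_pos, hV.card_right]
      omega
    have hd2 := (hkl' 0 d).mp hd
    have hw2 := (hkl' 1 w).mp hw
    have hw1 : V 1 w := hw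
    rw [h] at hd hd2 hw1 hw2
    rw [mul_zero, zero_pow (by omega), mul_zero, zero_add] at hd2
    rw [zero_pow (by omega), mul_zero, zero_add] at hd
    rw [mul_pow] at hd2
    have hl : (l : K) ^ q = l := by
      have h1 : ((l : K) ^ q - l) * (b ^ q * d ^ q) = 0 := by
        linear_combination hd2 - l * hd
      exact sub_eq_zero.mp ((mul_eq_zero.mp h1).resolve_right
        (mul_ne_zero (pow_ne_zero _ hb) (pow_ne_zero _ hd0)))
    rw [mul_one, mul_pow (l : K), hl] at hw2
    rw [one_pow, mul_one] at hw1
    rw [Units.val_pow_eq_pow_val]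
    refine mul_left_cancel₀ ha ?_
    linear_combination hw2 - l * hw1

/-- The equation of a classical unital in the chart of a tangent frame. The mixed terms vanish
because the polar lines of the two points of the frame are their tangents. -/
theorem IsTangentFrame.exists_equation (hU : IsUnital q U) (hcard : Fintype.card K = q ^ 2)
    {A : GL (Fin 3) K} (hA : IsTangentFrame q U A) (hcl : IsClassicalUnital q U) :
    ∃ a b : K, a ≠ 0 ∧ b ≠ 0 ∧
      ∀ y w, HasCoords U A 1 y w ↔ a * y ^ (q + 1) + (b * w + b ^ q * w ^ q) = 0 := by
  have hq := one_lt_of_card_eq_sq hcard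
  have h0 : (0 : K) ^ q = 0 := zero_pow (by omega)
  obtain ⟨G, hG, -, h⟩ := (isClassicalUnital_iff_frame hcard A).mp hcl
  have hvec : ∀ x y z, ![x, y, z] ≠ 0 → (HasCoords U A x y z ↔
      x ^ q * (G 0 0 * x + G 0 1 * y + G 0 2 * z) + y ^ q * (G 1 0 * x + G 1 1 * y + G 1 2 * z) +
        z ^ q * (G 2 0 * x + G 2 1 * y + G 2 2 * z) = 0) := by
    intro x y z hv
    rw [HasCoords, h _ hv, unitaryPairing_vec]
  have hne0 : ∀ y z : K, ![1, y, z] ≠ 0 := fun y z h => by simpa using congrFun h 0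
  have hne1 : ∀ x z : K, ![x, 1, z] ≠ 0 := fun x z h => by simpa using congrFun h 1
  have hne2 : ∀ x y : K, ![x, y, 1] ≠ 0 := fun x y h => by simpa using congrFun h 2
  have hV := hA.isUnitalChart hU hcard
  have hG00 : G 0 0 = 0 := by simpa [h0] using (hvec 1 0 0 (hne0 _ _)).mp hA.left_mem
  have hG22 : G 2 2 = 0 := by simpa [h0] using (hvec 0 0 1 (hne2 _ _)).mp hA.right_mem
  have hG11 : G 1 1 ≠ 0 := by
    intro h1
    refine hA.right_tangent 0 ((hvec 0 1 0 (hne1 _ _)).mpr ?_)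
    simp [h0, h1]
  simp only [hG00, hG22, zero_mul, zero_add, add_zero] at hvec
  have huniv : ∀ p : K → Prop, (∀ x, p x) → {x | p x}.ncard ≠ q := by
    intro p hp h1
    rw [Set.eq_univ_of_forall (s := {x | p x}) hp, Set.ncard_univ, Nat.card_eq_fintype_card, hcard]
      at h1
    have : q * 2 ≤ q * q := Nat.mul_le_mul_left q hq
    have : q ^ 2 = q * q := by ring
    omega
  have hG02 : G 0 2 ≠ 0 := by
    intro h1
    refine huniv _ (fun w => ?_) (hV.card_right 0)
    rw [hvec _ _ _ (hne0 _ _), hG 0 2, h1, h0]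
    ring
  have hG01 : G 0 1 = 0 := by
    by_contra h1
    have hs : -G 0 1 / G 0 2 ≠ 0 := div_ne_zero (neg_ne_zero.mpr h1) hG02
    have h2 := hA.card_left _ hs
    obtain ⟨x₀, hx₀⟩ : {x | HasCoords U A x 1 (-G 0 1 / G 0 2)}.Nonempty := by
      rw [← Set.ncard_pos, h2]; omega
    refine huniv _ (fun x => ?_) h2
    have hx₁ : HasCoords U A x₀ 1 (-G 0 1 / G 0 2) := hx₀
    have h3 : G 0 1 + G 0 2 * (-G 0 1 / G 0 2) = 0 := by
      rw [mul_div_cancel₀ _ hG02, add_neg_cancel]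
    have h4 : G 1 0 + G 2 0 * (-G 0 1 / G 0 2) ^ q = 0 := by
      rw [hG 0 1, hG 0 2, ← mul_pow, ← add_pow_q hcard, h3, h0]
    rw [hvec _ _ _ (hne1 _ _)] at hx₁ ⊢
    rw [one_pow] at hx₁ ⊢
    linear_combination hx₁ + (x ^ q - x₀ ^ q) * h3 + (x - x₀) * h4
  have hG21 : G 2 1 = 0 := by
    by_contra h1
    have hG20 : G 2 0 ≠ 0 := by
      rw [hG 0 2]
      exact pow_ne_zero _ hG02
    have hs : -G 2 1 / G 2 0 ≠ 0 := div_ne_zero (neg_ne_zero.mpr h1) hG20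
    have h2 := hA.card_right _ hs
    obtain ⟨z₀, hz₀⟩ : {z | HasCoords U A (-G 2 1 / G 2 0) 1 z}.Nonempty := by
      rw [← Set.ncard_pos, h2]; omega
    refine huniv _ (fun z => ?_) h2
    have hz₁ : HasCoords U A (-G 2 1 / G 2 0) 1 z₀ := hz₀
    have h3 : G 2 1 + G 2 0 * (-G 2 1 / G 2 0) = 0 := by
      rw [mul_div_cancel₀ _ hG20, add_neg_cancel]
    have h4 : G 1 2 + G 0 2 * (-G 2 1 / G 2 0) ^ q = 0 := by
      rw [hG 2 1, hG 2 0, ← mul_pow, ← add_pow_q hcard, h3, h0]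
    rw [hvec _ _ _ (hne1 _ _)] at hz₁ ⊢
    rw [one_pow] at hz₁ ⊢
    linear_combination hz₁ + (z ^ q - z₀ ^ q) * h3 + (z - z₀) * h4
  refine ⟨G 1 1, G 0 2, hG11, hG02, fun y w => ?_⟩
  rw [hvec _ _ _ (hne0 _ _), hG 0 1, hG 2 1, hG 0 2, hG01, hG21, h0, one_pow]
  ring_nf

end Hermitian

theorem theorem1 {K : Type*} [Field K] [Finite K] (q : ℕ) (hq : Nat.card K = q ^ 2)
    (U : Set (PlanePoint K)) (hU : IsUnital q U) :
    IsClassicalUnital q U ↔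
      ∃ P ∈ U, ∃ Q ∈ U, P ≠ Q ∧ Nat.card (twoPointStabilizer U P Q) = q ^ 2 - 1 := by
  have := Fintype.ofFinite K
  have hcard : Fintype.card K = q ^ 2 := by rw [← Nat.card_eq_fintype_card, hq]
  have hq1 := one_lt_of_card_eq_sq hcard
  constructor
  · intro hcl
    have h1 : 1 < U.ncard := by
      rw [hU.1]
      have := Nat.pow_pos (n := 3) (show 0 < q by omega)
      omega
    obtain ⟨P, hP, Q, hQ, hPQ⟩ := 
      (Set.one_lt_ncard (Set.finite_of_ncard_pos (by omega))).mp h1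
    obtain ⟨A, hA, hAP, hAQ⟩ := hU.exists_isTangentFrame hcard hP hQ hPQ
    obtain ⟨a, b, ha, hb, h⟩ := hA.exists_equation hU hcard hcl
    refine ⟨P, hP, Q, hQ, hPQ, ?_⟩
    rw [hA.card_twoPointStabilizer (by omega) hAP hAQ,
      card_chartGroup (hA.isUnitalChart hU hcard) hcard ha hb h]
  · rintro ⟨P, hP, Q, hQ, hPQ, hst⟩
    obtain ⟨A, hA, hAP, hAQ⟩ := hU.exists_isTangentFrame hcard hP hQ hPQ
    rw [hA.card_twoPointStabilizer (by omega) hAP hAQ] at hst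
    obtain ⟨c, ψ, hψ, hV⟩ := (hA.isUnitalChart hU hcard).exists_isUnitalFunction hcard hst
    obtain ⟨b, hb, hbψ⟩ := hψ.exists_eq_trace hcard
    exact hA.isClassicalUnital hcard hb fun y w => by rw [hV, hbψ]
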